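/- Let $(M,g)$ be an oriented smooth Riemannian $4$-manifold with Levi-Civita connection $D$, curvature $R_{X,Y}=[D_X,D_Y]-D_{[X,Y]}$ and normalized scalar curvature $s=\tfrac16\,\mathrm{scal}_g$. Skew endomorphisms $A$ of $TM$ are identified with $2$-forms by $A\mapsto\langle A\cdot,\cdot\rangle$, and $A^-=\tfrac12(A-{*A})$ denotes the antiselfdual part, where $*$ is the Hodge star. For a $1$-form $\gamma$ and a tangent vector $X$ let $\gamma\vartriangle X$ be the skew endomorphism $Y\mapsto\gamma(Y)X-\langle X,Y\rangle\,\gamma^\sharp$, where $\gamma^\sharp$ is the vector field dual to $\gamma$. A smooth vector field $K$ is a Killing field if $DK\colon X\mapsto D_XK$ is skew. A smooth antiselfdual endomorphism field $\Psi$ of $TM$ (so $\Psi$ is skew and $\Psi^-=\Psi$) is a twistor if there is a smooth $1$-form $\gamma$ such that $D_X\Psi=(\gamma\vartriangle X)^-$ for all $X$. Suppose that $g$ is Einstein ($\mathrm{Ric}_g=c\,g$ for a constant $c$) and selfdual (the antiselfdual part $W^-$ of the Weyl curvature vanishes). (i) If $K$ is a Killing field and $\Psi=(DK)^-$, then $$D_X\Psi=\tfrac12\,s\,\bigl(\langle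 K,\cdot\rangle\vartriangle X\bigr)^-\quad\text{for all }X,$$ and so $\Psi$ is a twistor. (ii) If $\Psi$ is a twistor with $D_X\Psi=(\gamma\vartriangle X)^-$ for all $X$, then $\gamma^\sharp$ is a Killing field and $$(D\gamma)^-=\tfrac12\,s\,\langle\Psi\cdot,\cdot\rangle .$$ -/

import Mathlib

set_option linter.unusedSectionVars false

open Bundle Manifold
open scoped ContDiff InnerProductSpace

namespace SelfdualEinstein

section LinearAlgebra

variable {V : Type*} [NormedAddCommGroup V] [InnerProductSpace ℝ V] [FiniteDimensional ℝ V]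

/-- The vector dual to a covector with respect to the inner product. -/
noncomputable def sharp : (V →L[ℝ] ℝ) →L[ℝ] V :=
  haveI : CompleteSpace V := FiniteDimensional.complete ℝ V
  LinearMap.toContinuousLinearMap
    { toFun := fun γ ↦ (InnerProductSpace.toDual ℝ V).symm γ
      map_add' := fun γ γ' ↦ map_add _ γ γ'
      map_smul' := fun c γ ↦ by simp }

theorem inner_sharp (γ : V →L[ℝ] ℝ) (v : V) : ⟪sharp γ, v⟫_ℝ = γ v := by
  have : CompleteSpace V := FiniteDimensional.complete ℝ V
  exact InnerProductSpace.toDual_symm_apply (𝕜 := ℝ) (E := V) (x := v) (y := γ)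

/-- The skew endomorphism `γ △ X`, given by `Y ↦ γ(Y) X - ⟪X, Y⟫ γ♯`. -/
noncomputable def wedge (γ : V →L[ℝ] ℝ) (X : V) : V →L[ℝ] V :=
  γ.smulRight X - (innerSL ℝ X).smulRight (sharp γ)

variable [Fact (Module.finrank ℝ V = 4)] (o : Orientation ℝ V (Fin 4))

/-- The Hodge star of a `2`-form `β` on an oriented four-dimensional inner product space:
`(∗β)(u, v) = ½ ∑ i j, β(e i, e j) vol(e i, e j, u, v)` for an orthonormal basis `e`
(the value does not depend on the basis). -/
noncomputable def hodgeStar (β : V → V → ℝ) (u v : V) : ℝ :=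
  (1 / 2) * ∑ i, ∑ j, β (stdOrthonormalBasis ℝ V i) (stdOrthonormalBasis ℝ V j) *
    o.volumeForm ![stdOrthonormalBasis ℝ V i, stdOrthonormalBasis ℝ V j, u, v]

/-- The antiselfdual part `β⁻ = ½ (β - ∗β)` of a `2`-form `β`. -/
noncomputable def asdForm (β : V → V → ℝ) (u v : V) : ℝ :=
  (1 / 2) * (β u v - hodgeStar o β u v)

theorem volumeForm_add_third (a b u u' v : V) : o.volumeForm ![a, b, u + u', v] =
    o.volumeForm ![a, b, u, v] + o.volumeForm ![a, b, u', v] := by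
  have h (w : V) : (![a, b, w, v] : Fin 4 → V) = Function.update ![a, b, 0, v] 2 w := by
    ext i; fin_cases i <;> rfl
  rw [h, h u, h u', AlternatingMap.map_update_add]

theorem volumeForm_smul_third (c : ℝ) (a b u v : V) : o.volumeForm ![a, b, c • u, v] =
    c * o.volumeForm ![a, b, u, v] := by
  have h (w : V) : (![a, b, w, v] : Fin 4 → V) = Function.update ![a, b, 0, v] 2 w := by
    ext i; fin_cases i <;> rfl
  rw [h, h u, AlternatingMap.map_update_smul, smul_eq_mul]

/-- The Hodge star on skew endomorphisms, identified with `2`-forms by `A ↦ ⟪A ·, ·⟫`. -/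
noncomputable def hodgeStarEnd (A : V →L[ℝ] V) : V →L[ℝ] V :=
  LinearMap.toContinuousLinearMap
    { toFun := fun u ↦ ∑ k, hodgeStar o (fun a b ↦ ⟪A a, b⟫_ℝ) u (stdOrthonormalBasis ℝ V k) •
        stdOrthonormalBasis ℝ V k
      map_add' := fun u u' ↦ by
        simp only [hodgeStar, volumeForm_add_third, mul_add, Finset.sum_add_distrib, add_smul]
      map_smul' := fun c u ↦ by
        simp only [hodgeStar, volumeForm_smul_third, RingHom.id_apply, Finset.smul_sum, smul_smul,
          Finset.mul_sum]
        refine Finset.sum_congr rfl fun k _ ↦ congrArg (· • _) ?_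
        exact Finset.sum_congr rfl fun i _ ↦ Finset.sum_congr rfl fun j _ ↦ by ring }

/-- The antiselfdual part `A⁻ = ½ (A - ∗A)` of a skew endomorphism `A`. -/
noncomputable def asdEnd (A : V →L[ℝ] V) : V →L[ℝ] V :=
  (1 / 2 : ℝ) • (A - hodgeStarEnd o A)

/-- `A` is an antiselfdual endomorphism: it is skew and equal to its antiselfdual part. -/
def IsAntiselfdualEnd (A : V →L[ℝ] V) : Prop :=
  (∀ u v, ⟪A u, v⟫_ℝ = -⟪u, A v⟫_ℝ) ∧ asdEnd o A = A

end LinearAlgebra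

section LeviCivita

variable {E : Type*} [NormedAddCommGroup E] [NormedSpace ℝ E] 
  {H : Type*} [TopologicalSpace H] (I : ModelWithCorners ℝ E H)
  {M : Type*} [TopologicalSpace M] [ChartedSpace H M] 

instance [FiniteDimensional ℝ E] (x : M) : FiniteDimensional ℝ (TangentSpace I x) :=
  inferInstanceAs (FiniteDimensional ℝ E)

variable [RiemannianBundle (fun x : M ↦ TangentSpace I x)]

/-- The right-hand side of the Koszul formula for `2 ⟪D_X Y, Z⟫`. -/
noncomputable def koszul (Y X Z : ∀ x : M, TangentSpace I x) (x : M) : ℝ :=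
  mvfderiv I (fun y ↦ ⟪Y y, Z y⟫_ℝ) x (X x) + mvfderiv I (fun y ↦ ⟪X y, Z y⟫_ℝ) x (Y x)
    - mvfderiv I (fun y ↦ ⟪X y, Y y⟫_ℝ) x (Z x)
    + ⟪VectorField.mlieBracket I X Y x, Z x⟫_ℝ - ⟪VectorField.mlieBracket I X Z x, Y x⟫_ℝ
    - ⟪VectorField.mlieBracket I Y Z x, X x⟫_ℝ

variable [IsManifold I ∞ M]
  [IsContMDiffRiemannianBundle I ∞ E (fun x : M ↦ TangentSpace I x)]

theorem mdifferentiableAt_inner {X Y : ∀ x : M, TangentSpace I x} {x : M} 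
    (hX : MDiffAt (T% X) x)
    (hY : MDiffAt (T% Y) x) :
    MDifferentiableAt I 𝓘(ℝ) (fun y ↦ ⟪X y, Y y⟫_ℝ) x :=
  MDifferentiableAt.inner_bundle (IB := I) (F := E) (E := fun x : M ↦ TangentSpace I x) hX hY

variable [FiniteDimensional ℝ E]

theorem koszul_tensorial_left (Y : ∀ x : M, TangentSpace I x) (x : M) 
    (hY : MDiffAt (T% Y) x)
    (Z : ∀ x : M, TangentSpace I x)
    (hZ : MDiffAt (T% Z) x) :
    TensorialAt I E (fun X ↦ koszul I Y X Z x) x where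
  smul {f X} hf hX := by
    have hXZ := mdifferentiableAt_inner I hX hZ
    have hXY := mdifferentiableAt_inner I hX hY
    simp only [koszul, Pi.smul_apply', inner_smul_left, inner_smul_right,
      VectorField.mlieBracket_smul_left hf hX]
    simp [mvfderiv_fun_mul hf hXZ, mvfderiv_fun_mul hf hXY, inner_add_left, inner_smul_left]
    ring_nf
  add {X X'} hX hX' := by
    simp only [koszul, Pi.add_apply, inner_add_left, inner_add_right,
      VectorField.mlieBracket_add_left hX hX',
      mvfderiv_fun_add (mdifferentiableAt_inner I hX hZ) (mdifferentiableAt_inner I hX' hZ), 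
      mvfderiv_fun_add (mdifferentiableAt_inner I hX hY) (mdifferentiableAt_inner I hX' hY)]
    simp
    ring

theorem koszul_tensorial_right (Y : ∀ x : M, TangentSpace I x) (x : M) 
    (hY : MDiffAt (T% Y) x)
    (X : ∀ x : M, TangentSpace I x)
    (hX : MDiffAt (T% X) x) :
    TensorialAt I E (fun Z ↦ koszul I Y X Z x) x where
  smul {f Z} hf hZ := by
    have hXZ := mdifferentiableAt_inner I hX hZ
    have hYZ := mdifferentiableAt_inner I hY hZ
    simp only [koszul, Pi.smul_apply', inner_smul_right,
      VectorField.mlieBracket_smul_right hf hZ]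
    simp [mvfderiv_fun_mul hf hXZ, mvfderiv_fun_mul hf hYZ, inner_add_left, inner_smul_left]
    rw [real_inner_comm (X x) (Z x), real_inner_comm (Y x) (Z x)]
    ring_nf
  add {Z Z'} hZ hZ' := by
    simp only [koszul, Pi.add_apply, inner_add_left, inner_add_right,
      VectorField.mlieBracket_add_right hZ hZ',
      mvfderiv_fun_add (mdifferentiableAt_inner I hX hZ) (mdifferentiableAt_inner I hX hZ'), 
      mvfderiv_fun_add (mdifferentiableAt_inner I hY hZ) (mdifferentiableAt_inner I hY hZ')]
    simp
    ring

open Classical in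
/-- `leviCivitaAux I Y x` is `u ↦ D_u Y`, the endomorphism of `T_x M` characterised by the Koszul
formula (and the junk value `0` where `Y` is not differentiable). -/
noncomputable def leviCivitaAux (Y : ∀ x : M, TangentSpace I x) (x : M) :
    TangentSpace I x →L[ℝ] TangentSpace I x :=
  if hY : MDiffAt (T% Y) x then
    (1 / 2 : ℝ) • sharp ∘L TensorialAt.mkHom₂ (fun X Z ↦ koszul I Y X Z x) x
      (koszul_tensorial_left I Y x hY) (koszul_tensorial_right I Y x hY)
  else 0

theorem inner_leviCivitaAux {Y X Z : ∀ x : M, TangentSpace I x} {x : M}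
    (hY : MDiffAt (T% Y) x)
    (hX : MDiffAt (T% X) x)
    (hZ : MDiffAt (T% Z) x) :
    ⟪leviCivitaAux I Y x (X x), Z x⟫_ℝ = koszul I Y X Z x / 2 := by
  rw [leviCivitaAux, dif_pos hY]
  simp only [smul_apply, ContinuousLinearMap.comp_apply, inner_smul_left,
    inner_sharp]
  rw [TensorialAt.mkHom₂_apply _ _ hX hZ]
  simp
  ring


theorem clm_ext_of_fields {x : M} {A B : TangentSpace I x →L[ℝ] TangentSpace I x}
    (h : ∀ X Z : ∀ x : M, TangentSpace I x, MDiffAt (T% X) x → MDiffAt (T% Z) x →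
      ⟪A (X x), Z x⟫_ℝ = ⟪B (X x), Z x⟫_ℝ) : A = B := by
  ext u
  refine ext_inner_right ℝ fun v ↦ ?_
  have := h (FiberBundle.extend E u) (FiberBundle.extend E v)
    (FiberBundle.mdifferentiableAt_extend ..) (FiberBundle.mdifferentiableAt_extend ..)
  simpa using this

/-- The Levi-Civita connection `D` of the Riemannian metric, on vector fields: `leviCivita I Y x u`
is `(D_u Y)(x)`. -/
noncomputable def leviCivita : CovariantDerivative I E (fun x : M ↦ TangentSpace I x) where
  toFun := leviCivitaAux I
  isCovariantDerivativeOnUniv :=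
    { add := by
        intro Y Y' x hY hY' _
        refine clm_ext_of_fields I fun X Z hX hZ ↦ ?_
        rw [inner_leviCivitaAux I (mdifferentiableAt_add_section hY hY') hX hZ, add_apply,
          inner_add_left, inner_leviCivitaAux I hY hX hZ, inner_leviCivitaAux I hY' hX hZ]
        simp only [koszul, Pi.add_apply, inner_add_left, inner_add_right,
          VectorField.mlieBracket_add_right hY hY', VectorField.mlieBracket_add_left hY hY',
          mvfderiv_fun_add (mdifferentiableAt_inner I hY hZ) (mdifferentiableAt_inner I hY' hZ),
          mvfderiv_fun_add (mdifferentiableAt_inner I hX hY) (mdifferentiableAt_inner I hX hY')]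
        simp
        ring
      leibniz := by
        intro Y f x hY hf _
        refine clm_ext_of_fields I fun X Z hX hZ ↦ ?_
        have hXY := mdifferentiableAt_inner I hX hY
        have hYZ := mdifferentiableAt_inner I hY hZ
        rw [inner_leviCivitaAux I (hf.smul_section hY) hX hZ]
        simp only [add_apply, smul_apply, inner_add_left, inner_smul_left,
          inner_leviCivitaAux I hY hX hZ, ContinuousLinearMap.smulRight_apply]
        simp only [koszul, Pi.smul_apply', inner_smul_left, inner_smul_right,
          VectorField.mlieBracket_smul_left hf hY, VectorField.mlieBracket_smul_right hf hY]
        simp [mvfderiv_fun_mul hf hXY, mvfderiv_fun_mul hf hYZ, inner_add_left, inner_smul_left]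
        rw [real_inner_comm (Y x) (X x)]
        ring }

/-- The Levi-Civita connection is torsion-free. -/
theorem leviCivita_torsion : (leviCivita I (M := M)).torsion = 0 := by
  rw [CovariantDerivative.torsion_eq_zero_iff]
  intro X Y x hX hY
  refine ext_inner_right ℝ fun v ↦ ?_
  have hZ : MDiffAt (T% (FiberBundle.extend E v)) x := FiberBundle.mdifferentiableAt_extend ..
  have h1 := inner_leviCivitaAux I hY hX hZ
  have h2 := inner_leviCivitaAux I hX hY hZ
  have h3 := VectorField.mlieBracket_swap_apply (I := I) (V := Y) (W := X) (x := x)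
  change ⟪leviCivitaAux I Y x (X x) - leviCivitaAux I X x (Y x), v⟫_ℝ = _
  simp only [FiberBundle.extend_apply_self] at h1 h2
  rw [inner_sub_left, h1, h2]
  simp only [koszul, h3, inner_neg_left, FiberBundle.extend_apply_self, real_inner_comm]
  ring

/-- The Levi-Civita connection preserves the metric. -/
theorem leviCivita_metric {X Y Z : ∀ x : M, TangentSpace I x} {x : M}
    (hX : MDiffAt (T% X) x) (hY : MDiffAt (T% Y) x) (hZ : MDiffAt (T% Z) x) :
    mvfderiv I (fun y ↦ ⟪Y y, Z y⟫_ℝ) x (X x) =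
      ⟪leviCivita I Y x (X x), Z x⟫_ℝ + ⟪Y x, leviCivita I Z x (X x)⟫_ℝ := by
  have h1 := inner_leviCivitaAux I hY hX hZ
  have h2 := inner_leviCivitaAux I hZ hX hY
  have h3 := VectorField.mlieBracket_swap_apply (I := I) (V := Y) (W := Z) (x := x)
  change _ = ⟪leviCivitaAux I Y x (X x), Z x⟫_ℝ + ⟪Y x, leviCivitaAux I Z x (X x)⟫_ℝ
  rw [real_inner_comm _ (Y x), h1, h2]
  simp only [koszul, h3, inner_neg_left, real_inner_comm]
  ring

end LeviCivita

section Curvature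

variable {E : Type*} [NormedAddCommGroup E] [NormedSpace ℝ E] [FiniteDimensional ℝ E]
  {H : Type*} [TopologicalSpace H] (I : ModelWithCorners ℝ E H)
  {M : Type*} [TopologicalSpace M] [ChartedSpace H M] [IsManifold I ∞ M]
  [RiemannianBundle (fun x : M ↦ TangentSpace I x)]
  [IsContMDiffRiemannianBundle I ∞ E (fun x : M ↦ TangentSpace I x)]

/-! In the following definitions tangent vectors at `x` are extended by `FiberBundle.extend` to
vector fields that are smooth near `x`; the values do not depend on the extension. -/

/-- The Riemann curvature `R_{u,v} w = D_u D_v w - D_v D_u w - D_{[u,v]} w` at `x`. -/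
noncomputable def riemann (x : M) (u v w : TangentSpace I x) : TangentSpace I x :=
  let U : ∀ y : M, TangentSpace I y := FiberBundle.extend E u
  let V : ∀ y : M, TangentSpace I y := FiberBundle.extend E v
  let W : ∀ y : M, TangentSpace I y := FiberBundle.extend E w
  leviCivita I (fun y ↦ leviCivita I W y (V y)) x u
    - leviCivita I (fun y ↦ leviCivita I W y (U y)) x v
    - leviCivita I W x (VectorField.mlieBracket I U V x)

/-- The Ricci curvature, the trace of `e ↦ R_{e,u} v`. -/
noncomputable def ricci (x : M) (u v : TangentSpace I x) : ℝ :=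
  ∑ i, ⟪riemann I x (stdOrthonormalBasis ℝ (TangentSpace I x) i) u v,
    stdOrthonormalBasis ℝ (TangentSpace I x) i⟫_ℝ

/-- The scalar curvature, the metric trace of the Ricci curvature. -/
noncomputable def scal (x : M) : ℝ :=
  ∑ i, ricci I x (stdOrthonormalBasis ℝ (TangentSpace I x) i)
    (stdOrthonormalBasis ℝ (TangentSpace I x) i)

/-- The covariant derivative `(D_u Ψ)(w) = D_u(Ψ w) - Ψ(D_u w)` of an endomorphism field. -/
noncomputable def covDerivEnd (Ψ : ∀ x : M, TangentSpace I x →L[ℝ] TangentSpace I x) (x : M)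
    (u w : TangentSpace I x) : TangentSpace I x :=
  let W : ∀ y : M, TangentSpace I y := FiberBundle.extend E w
  leviCivita I (fun y ↦ Ψ y (W y)) x u - Ψ x (leviCivita I W x u)

/-- The covariant derivative `(D_u γ)(w) = u(γ(w)) - γ(D_u w)` of a `1`-form. -/
noncomputable def covDerivForm (γ : ∀ x : M, TangentSpace I x →L[ℝ] ℝ) (x : M)
    (u w : TangentSpace I x) : ℝ :=
  let W : ∀ y : M, TangentSpace I y := FiberBundle.extend E w
  mvfderiv I (fun y ↦ γ y (W y)) x u - γ x (leviCivita I W x u)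

/-- A Killing field: a smooth vector field `K` for which `D K : u ↦ D_u K` is skew. -/
def IsKilling (K : ∀ x : M, TangentSpace I x) : Prop :=
  ContMDiff I I.tangent ∞ (fun x ↦ (⟨x, K x⟩ : TangentBundle I M)) ∧
    ∀ (x : M) (u v : TangentSpace I x),
      ⟪leviCivita I K x u, v⟫_ℝ = -⟪u, leviCivita I K x v⟫_ℝ

end Curvature

section FourManifold

variable {M : Type*} [TopologicalSpace M] [ChartedSpace (EuclideanSpace ℝ (Fin 4)) M]

instance factFinrankTangentSpace (x : M) : Fact (Module.finrank ℝ (TangentSpace (𝓡 4) x) = 4) :=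
  ⟨(finrank_euclideanSpace_fin : Module.finrank ℝ (EuclideanSpace ℝ (Fin 4)) = 4)⟩

variable [IsManifold (𝓡 4) ∞ M]
  [RiemannianBundle (fun x : M ↦ TangentSpace (𝓡 4) x)]

/-- A choice of orientations of the tangent spaces is an orientation of the manifold if every
positively oriented frame of continuous vector fields at a point is positively oriented nearby. -/
def IsManifoldOrientation (o : ∀ x : M, Orientation ℝ (TangentSpace (𝓡 4) x) (Fin 4)) : Prop :=
  ∀ (x : M) (e : Fin 4 → ∀ y : M, TangentSpace (𝓡 4) y),
    (∀ i, ContinuousAt (fun y ↦ (⟨y, e i y⟩ : TangentBundle (𝓡 4) M)) x) →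
    0 < (o x).volumeForm (fun i ↦ e i x) →
    ∀ᶠ y in nhds x, 0 < (o y).volumeForm (fun i ↦ e i y)

variable [IsContMDiffRiemannianBundle (𝓡 4) ∞ (EuclideanSpace ℝ (Fin 4))
    (fun x : M ↦ TangentSpace (𝓡 4) x)]

/-- The Weyl curvature `⟪W_{u,v} w, z⟫` of a Riemannian `4`-manifold. -/
noncomputable def weyl (x : M) (u v w z : TangentSpace (𝓡 4) x) : ℝ :=
  ⟪riemann (𝓡 4) x u v w, z⟫_ℝ
    - (1 / 2) * (ricci (𝓡 4) x v w * ⟪u, z⟫_ℝ - ricci (𝓡 4) x u w * ⟪v, z⟫_ℝ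
      + ⟪v, w⟫_ℝ * ricci (𝓡 4) x u z - ⟪u, w⟫_ℝ * ricci (𝓡 4) x v z)
    + (scal (𝓡 4) x / 6) * (⟪v, w⟫_ℝ * ⟪u, z⟫_ℝ - ⟪u, w⟫_ℝ * ⟪v, z⟫_ℝ)

variable (M) in
/-- The metric is Einstein: `Ric = c g` for a real constant `c`. -/
def IsEinstein : Prop :=
  ∃ c : ℝ, ∀ (x : M) (u v : TangentSpace (𝓡 4) x), ricci (𝓡 4) x u v = c * ⟪u, v⟫_ℝ

/-- The metric is selfdual: the antiselfdual part of the Weyl curvature vanishes. -/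
def IsSelfdual (o : ∀ x : M, Orientation ℝ (TangentSpace (𝓡 4) x) (Fin 4)) : Prop :=
  ∀ (x : M) (u v w z : TangentSpace (𝓡 4) x), asdForm (o x) (weyl x u v) w z = 0

/-- The normalized scalar curvature `s = scal / 6`. -/
noncomputable def normScal (x : M) : ℝ := scal (𝓡 4) x / 6

/-- `Ψ = (D K)⁻`. -/
noncomputable def asdDeriv (o : ∀ x : M, Orientation ℝ (TangentSpace (𝓡 4) x) (Fin 4))
    (K : ∀ x : M, TangentSpace (𝓡 4) x) (x : M) :
    TangentSpace (𝓡 4) x →L[ℝ] TangentSpace (𝓡 4) x :=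
  asdEnd (o x) (leviCivita (𝓡 4) K x)

/-- `Ψ` is a (smooth) antiselfdual endomorphism field which satisfies, with the (smooth) `1`-form
`γ`, the twistor equation `D_X Ψ = (γ △ X)⁻` for all `X`. -/
structure IsTwistorWith (o : ∀ x : M, Orientation ℝ (TangentSpace (𝓡 4) x) (Fin 4))
    (Ψ : ∀ x : M, TangentSpace (𝓡 4) x →L[ℝ] TangentSpace (𝓡 4) x)
    (γ : ∀ x : M, TangentSpace (𝓡 4) x →L[ℝ] ℝ) : Prop where
  smooth_endomorphism : ContMDiff (𝓡 4)
    ((𝓡 4).prod 𝓘(ℝ, EuclideanSpace ℝ (Fin 4) →L[ℝ] EuclideanSpace ℝ (Fin 4))) ∞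
    (fun x ↦ TotalSpace.mk' (EuclideanSpace ℝ (Fin 4) →L[ℝ] EuclideanSpace ℝ (Fin 4))
      (E := fun x : M ↦ TangentSpace (𝓡 4) x →L[ℝ] TangentSpace (𝓡 4) x) x (Ψ x))
  smooth_form : ContMDiff (𝓡 4) ((𝓡 4).prod 𝓘(ℝ, EuclideanSpace ℝ (Fin 4) →L[ℝ] ℝ)) ∞
    (fun x ↦ TotalSpace.mk' (EuclideanSpace ℝ (Fin 4) →L[ℝ] ℝ)
      (E := fun x : M ↦ TangentSpace (𝓡 4) x →L[ℝ] ℝ) x (γ x))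
  antiselfdual : ∀ x, IsAntiselfdualEnd (o x) (Ψ x)
  equation : ∀ (x : M) (X Y : TangentSpace (𝓡 4) x),
    covDerivEnd (𝓡 4) Ψ x X Y = asdEnd (o x) (wedge (γ x) X) Y

/-- `Ψ` is a twistor: it satisfies the twistor equation with some `1`-form. -/
def IsTwistor (o : ∀ x : M, Orientation ℝ (TangentSpace (𝓡 4) x) (Fin 4))
    (Ψ : ∀ x : M, TangentSpace (𝓡 4) x →L[ℝ] TangentSpace (𝓡 4) x) : Prop :=
  ∃ γ : ∀ x : M, TangentSpace (𝓡 4) x →L[ℝ] ℝ, IsTwistorWith o Ψ γ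

end FourManifold

end SelfdualEinstein

open SelfdualEinstein

/-!
Everything follows from two facts. On a selfdual Einstein `4`-manifold with `Ric = c g` the
antiselfdual part of the curvature endomorphism `R_{u,v}` is that of a space of constant curvature,
`(R_{u,v})⁻ = (c / 3) (v♭ △ u)⁻` (`IsSelfdual.asdEnd_riemann`), where `c / 3 = s / 2`. And the
projection `A ↦ A⁻` is parallel, `D_u (Ψ⁻) = (D_u Ψ)⁻` (`IsSkewField.covDerivEnd_asdEnd`): in a
positively oriented orthonormal frame the coefficients of the projection are constant, while the
connection term is a commutator with a skew endomorphism, with which the projection commutes.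

For a Killing field `K`, Kostant's identity `D_u (D K) = R_{u,K}`
(`IsKilling.covDerivEnd_leviCivita`) and the two facts give
`D_u ((D K)⁻) = (R_{u,K})⁻ = (c / 3) (K♭ △ u)⁻`.

Conversely let `D_u Ψ = (γ △ u)⁻` and let `B = D γ♯`. Differentiating once more, the Ricci identity
reads `[R_{u,v}, Ψ] = ((B u)♭ △ v - (B v)♭ △ u)⁻` (`curvature_commutator_of_twistor`). Selfdual
endomorphisms commute with `Ψ`, so only `(R_{u,v})⁻` contributes on the left, and the equation says
that `((C u)♭ △ v - (C v)♭ △ u)⁻ = 0` for `C = B - (c / 3) Ψ`. By linear algebra in dimension four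
such a `C` is skew with `C⁻ = 0` (`skew_of_asdEnd_wedge_eq_zero`), that is, `B` is skew and
`B⁻ = (c / 3) Ψ` (`skew_of_curvature_commutator`).

Antiselfdual parts are computed through the matrix in an oriented orthonormal basis
(`inner_asdEnd`). The smoothness of the derivatives that occur rests on the smoothness of `X f` for
a smooth function `f` and a smooth field `X`, which is read off from the Leibniz rule for the Lie
bracket (`contMDiffAt_mvfderiv`).
-/

set_option linter.unusedSectionVars false

open Bundle Manifold
open scoped ContDiff InnerProductSpace

namespace SelfdualEinstein

/-! ### Antiselfdual matrices -/

section Matrix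

/-- The Levi-Civita symbol `ε i j k l` on four indices, written as a Vandermonde product. -/
noncomputable def leviCivitaSymbol (i j k l : Fin 4) : ℝ :=
  (((j : ℕ) : ℝ) - (i : ℕ)) * (((k : ℕ) : ℝ) - (i : ℕ)) * (((l : ℕ) : ℝ) - (i : ℕ)) *
    (((k : ℕ) : ℝ) - (j : ℕ)) * (((l : ℕ) : ℝ) - (j : ℕ)) * (((l : ℕ) : ℝ) - (k : ℕ)) / 12

/-- The antiselfdual part of a bilinear form on `ℝ⁴` in coordinates. The Hodge star only sees the
skew part of `a`, whereas the first term is `a` itself; for skew `a` this is the usual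
projection. -/
noncomputable def asdMatrix (a : Fin 4 → Fin 4 → ℝ) (k l : Fin 4) : ℝ :=
  (1 / 2) * (a k l - (1 / 2) * ∑ i, ∑ j, a i j * leviCivitaSymbol i j k l)

theorem det_indicator_eq_leviCivitaSymbol (i j k l : Fin 4) :
    Matrix.det (Matrix.of fun a b : Fin 4 ↦ if ![i, j, k, l] a = b then (1 : ℝ) else 0) =
      leviCivitaSymbol i j k l := by
  -- Multiplying by the Vandermonde matrix of `0, 1, 2, 3`, whose determinant is `12`,
  -- gives the Vandermonde matrix of `i, j, k, l`.
  have h : (Matrix.of fun a b : Fin 4 ↦ if ![i, j, k, l] a = b then (1 : ℝ) else 0) *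
      Matrix.vandermonde (fun b : Fin 4 ↦ ((b : ℕ) : ℝ)) =
      Matrix.vandermonde (fun a ↦ ((![i, j, k, l] a : ℕ) : ℝ)) := by
    ext a b
    simp [Matrix.mul_apply, Matrix.vandermonde]
  have h' := congrArg Matrix.det h
  rw [Matrix.det_mul, Matrix.det_vandermonde, Matrix.det_vandermonde] at h'
  have i0 : Finset.Ioi (0 : Fin 4) = {1, 2, 3} := rfl
  have i1 : Finset.Ioi (1 : Fin 4) = {2, 3} := rfl
  have i2 : Finset.Ioi (2 : Fin 4) = {3} := rfl
  have i3 : Finset.Ioi (3 : Fin 4) = ∅ := rfl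
  simp [Fin.prod_univ_four, i0, i1, i2, i3] at h'
  norm_num at h'
  rw [leviCivitaSymbol]
  linarith

theorem asdMatrix_table (a : Fin 4 → Fin 4 → ℝ) :
    (∀ i, asdMatrix a i i = a i i / 2) ∧
    asdMatrix a 0 1 = (a 0 1 - (a 2 3 - a 3 2) / 2) / 2 ∧
    asdMatrix a 1 0 = (a 1 0 + (a 2 3 - a 3 2) / 2) / 2 ∧
    asdMatrix a 2 3 = (a 2 3 - (a 0 1 - a 1 0) / 2) / 2 ∧
    asdMatrix a 3 2 = (a 3 2 + (a 0 1 - a 1 0) / 2) / 2 ∧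
    asdMatrix a 0 2 = (a 0 2 + (a 1 3 - a 3 1) / 2) / 2 ∧
    asdMatrix a 2 0 = (a 2 0 - (a 1 3 - a 3 1) / 2) / 2 ∧
    asdMatrix a 1 3 = (a 1 3 + (a 0 2 - a 2 0) / 2) / 2 ∧
    asdMatrix a 3 1 = (a 3 1 - (a 0 2 - a 2 0) / 2) / 2 ∧
    asdMatrix a 0 3 = (a 0 3 - (a 1 2 - a 2 1) / 2) / 2 ∧
    asdMatrix a 3 0 = (a 3 0 + (a 1 2 - a 2 1) / 2) / 2 ∧
    asdMatrix a 1 2 = (a 1 2 - (a 0 3 - a 3 0) / 2) / 2 ∧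
    asdMatrix a 2 1 = (a 2 1 + (a 0 3 - a 3 0) / 2) / 2 := by
  refine ⟨fun i ↦ ?_, ?_⟩
  · simp [asdMatrix, leviCivitaSymbol]
    ring
  · refine ⟨?_, ?_, ?_, ?_, ?_, ?_, ?_, ?_, ?_, ?_, ?_, ?_⟩ <;>
    · simp [asdMatrix, leviCivitaSymbol, Fin.sum_univ_four]
      ring

theorem asdMatrix_add (a b : Fin 4 → Fin 4 → ℝ) (k l : Fin 4) :
    asdMatrix (fun i j ↦ a i j + b i j) k l = asdMatrix a k l + asdMatrix b k l := by
  simp only [asdMatrix, add_mul, Finset.sum_add_distrib]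
  ring

theorem asdMatrix_skew {a : Fin 4 → Fin 4 → ℝ} (ha : ∀ i j, a i j = -a j i) (k l : Fin 4) :
    asdMatrix a k l = -asdMatrix a l k := by
  obtain ⟨p, p01, p10, p23, p32, p02, p20, p13, p31, p03, p30, p12, p21⟩ := asdMatrix_table a
  have h0 (i) : a i i = 0 := by linarith [ha i i]
  have h1 := ha 1 0
  have h2 := ha 2 0
  have h3 := ha 3 0
  have h4 := ha 2 1
  have h5 := ha 3 1
  have h6 := ha 3 2
  fin_cases k <;> fin_cases l <;>
    simp only [Fin.zero_eta, Fin.mk_one, Fin.reduceFinMk, p, p01, p10, p23, p32, p02, p20, p13,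
      p31, p03, p30, p12, p21, h0, h1, h2, h3, h4, h5, h6] <;> ring

theorem asdMatrix_asdMatrix {a : Fin 4 → Fin 4 → ℝ} (ha : ∀ i j, a i j = -a j i) (k l : Fin 4) :
    asdMatrix (asdMatrix a) k l = asdMatrix a k l := by
  obtain ⟨p, p01, p10, p23, p32, p02, p20, p13, p31, p03, p30, p12, p21⟩ := asdMatrix_table a
  obtain ⟨q, q01, q10, q23, q32, q02, q20, q13, q31, q03, q30, q12, q21⟩ :=
    asdMatrix_table (asdMatrix a)
  have h0 (i) : a i i = 0 := by linarith [ha i i]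
  have h1 := ha 1 0
  have h2 := ha 2 0
  have h3 := ha 3 0
  have h4 := ha 2 1
  have h5 := ha 3 1
  have h6 := ha 3 2
  fin_cases k <;> fin_cases l <;>
    simp only [Fin.zero_eta, Fin.mk_one, Fin.reduceFinMk, q, q01, q10, q23, q32, q02, q20, q13,
      q31, q03, q30, q12, q21, p, p01, p10, p23, p32, p02, p20, p13,
      p31, p03, p30, p12, p21, h0, h1, h2, h3, h4, h5, h6] <;> ring

/-- The projection to antiselfdual forms is equivariant under the Lie algebra `so(4)`. -/
theorem asdMatrix_commutator (a t : Fin 4 → Fin 4 → ℝ) (ht : ∀ i j, t i j = -t j i)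
    (k l : Fin 4) :
    asdMatrix (fun i j ↦ ∑ m, a i m * t m j - ∑ m, t i m * a m j) k l =
      ∑ m, asdMatrix a k m * t m l - ∑ m, t k m * asdMatrix a m l := by
  have h0 (i) : t i i = 0 := by linarith [ht i i]
  have h1 := ht 1 0
  have h2 := ht 2 0
  have h3 := ht 3 0
  have h4 := ht 2 1
  have h5 := ht 3 1
  have h6 := ht 3 2
  obtain ⟨p, p01, p10, p23, p32, p02, p20, p13, p31, p03, p30, p12, p21⟩ := asdMatrix_table a
  obtain ⟨q, q01, q10, q23, q32, q02, q20, q13, q31, q03, q30, q12, q21⟩ := asdMatrix_table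
    (fun i j ↦ ∑ m, a i m * t m j - ∑ m, t i m * a m j)
  fin_cases k <;> fin_cases l <;>
    simp only [Fin.zero_eta, Fin.mk_one, Fin.reduceFinMk, q, q01, q10, q23, q32,
      q02, q20, q13, q31, q03, q30, q12, q21] <;>
    simp only [Fin.sum_univ_four, p, p01, p10, p23, p32,
      p02, p20, p13, p31, p03, p30, p12, p21, h0, h1, h2, h3, h4, h5, h6] <;>
    ring

/-- Selfdual and antiselfdual matrices commute. -/
theorem commute_of_asdMatrix (n p : Fin 4 → Fin 4 → ℝ) (hn : ∀ i j, n i j = -n j i)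
    (hp : ∀ i j, p i j = -p j i) (hn' : ∀ i j, asdMatrix n i j = 0)
    (hp' : ∀ i j, asdMatrix p i j = p i j) (k l : Fin 4) :
    ∑ m, p k m * n m l = ∑ m, n k m * p m l := by
  have n0 (i) : n i i = 0 := by linarith [hn i i]
  have p0 (i) : p i i = 0 := by linarith [hp i i]
  obtain ⟨-, p01, p10, p23, p32, p02, p20, p13, p31, p03, p30, p12, p21⟩ := asdMatrix_table p
  obtain ⟨-, q01, q10, q23, q32, q02, q20, q13, q31, q03, q30, q12, q21⟩ := asdMatrix_table n
  rw [hp'] at p01 p02 p03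
  rw [hn'] at q01 q02 q03
  have e1 : p 2 3 = -p 0 1 := by linarith [hp 3 2]
  have e2 : p 1 3 = p 0 2 := by linarith [hp 3 1]
  have e3 : p 1 2 = -p 0 3 := by linarith [hp 2 1]
  have f1 : n 2 3 = n 0 1 := by linarith [hn 3 2]
  have f2 : n 1 3 = -n 0 2 := by linarith [hn 3 1]
  have f3 : n 1 2 = n 0 3 := by linarith [hn 2 1]
  have h1 := hp 1 0
  have h2 := hp 2 0
  have h3 := hp 3 0
  have h4 := hp 2 1
  have h5 := hp 3 1
  have h6 := hp 3 2
  have g1 := hn 1 0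
  have g2 := hn 2 0
  have g3 := hn 3 0
  have g4 := hn 2 1
  have g5 := hn 3 1
  have g6 := hn 3 2
  fin_cases k <;> fin_cases l <;>
    simp only [Fin.zero_eta, Fin.mk_one, Fin.reduceFinMk, Fin.sum_univ_four, n0, p0, h1, h2, h3,
      h4, h5, h6, g1, g2, g3, g4, g5, g6, e1, e2, e3, f1, f2, f3] <;>
    ring

set_option maxHeartbeats 400000 in
/-- If the antiselfdual parts of all the forms `c eᵤ ∧ eᵥ + eᵤ ∧ c eᵥ` vanish then `c` is skew with
vanishing antiselfdual part. Indeed consider the derivation of `Λ²` induced by `c`, followed by the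
projection to `Λ⁻`. On `Λ⁻` it is a multiple of the identity, given by the trace of `c`, plus the
adjoint action of the antiselfdual part of `c`, and these are linearly independent. On `Λ⁺` it is
given by the trace-free symmetric part of `c` under the isomorphism with `Hom(Λ⁺, Λ⁻)`. -/
theorem skew_of_asdMatrix_eq_zero (c : Fin 4 → Fin 4 → ℝ)
    (h : ∀ u v k l, asdMatrix (fun i j ↦
      (c u i * (if v = j then 1 else 0) - (if v = i then 1 else 0) * c u j) -
      (c v i * (if u = j then 1 else 0) - (if u = i then 1 else 0) * c v j)) k l = 0) :
    (∀ i j, c i j = -c j i) ∧ ∀ i j, asdMatrix c i j = 0 := by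
  have key (u v) := by
    have := asdMatrix_table (fun i j ↦
      (c u i * (if v = j then 1 else 0) - (if v = i then 1 else 0) * c u j) -
      (c v i * (if u = j then 1 else 0) - (if u = i then 1 else 0) * c v j))
    simp only [h] at this
    exact this
  obtain ⟨-, a1, -, -, -, a2, -, -, -, a3, -⟩ := key 0 1
  obtain ⟨-, b1, -, -, -, b2, -, -, -, b3, -⟩ := key 0 2
  obtain ⟨-, c1, -, -, -, c2, -, -, -, c3, -⟩ := key 0 3
  obtain ⟨-, d1, -, -, -, d2, -, -, -, d3, -⟩ := key 1 2
  obtain ⟨-, e1, -, -, -, e2, -, -, -, e3, -⟩ := key 1 3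
  obtain ⟨-, f1, -, -, -, f2, -, -, -, f3, -⟩ := key 2 3
  clear h key
  simp at a1 a2 a3 b1 b2 b3 c1 c2 c3 d1 d2 d3 e1 e2 e3 f1 f2 f3
  have z0 : c 0 0 = 0 := by linarith
  have z1 : c 1 1 = 0 := by linarith
  have z2 : c 2 2 = 0 := by linarith
  have z3 : c 3 3 = 0 := by linarith
  have w1 : c 2 3 = c 0 1 := by linarith
  have w2 : c 3 2 = -c 0 1 := by linarith
  have w3 : c 1 0 = -c 0 1 := by linarith
  have w4 : c 3 1 = c 0 2 := by linarith
  have w5 : c 1 3 = -c 0 2 := by linarith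
  have w6 : c 2 0 = -c 0 2 := by linarith
  have w7 : c 1 2 = c 0 3 := by linarith
  have w8 : c 2 1 = -c 0 3 := by linarith
  have w9 : c 3 0 = -c 0 3 := by linarith
  obtain ⟨q, q01, q10, q23, q32, q02, q20, q13, q31, q03, q30, q12, q21⟩ := asdMatrix_table c
  constructor <;> intro i j <;> fin_cases i <;> fin_cases j <;>
    simp only [Fin.zero_eta, Fin.mk_one, Fin.reduceFinMk, q, q01, q10, q23, q32, q02, q20, q13,
      q31, q03, q30, q12, q21, z0, z1, z2, z3, w1, w2, w3, w4, w5, w6, w7, w8, w9] <;> ring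

end Matrix

/-! ### Antiselfdual endomorphisms in oriented orthonormal bases -/

section LinearAlgebra

variable {V : Type*} [NormedAddCommGroup V] [InnerProductSpace ℝ V] [FiniteDimensional ℝ V]

/-- The contraction of two linear forms does not depend on the orthonormal basis. -/
theorem sum_mul_orthonormalBasis {ι κ : Type*} [Fintype ι] [Fintype κ]
    (b : OrthonormalBasis ι ℝ V) (e : OrthonormalBasis κ ℝ V) (f g : V →ₗ[ℝ] ℝ) :
    ∑ i, f (b i) * g (b i) = ∑ k, f (e k) * g (e k) := by
  have h (i : ι) : f (b i) = ∑ k, ⟪e k, b i⟫_ℝ * f (e k) := by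
    conv_lhs => rw [← e.sum_repr' (b i)]
    simp
  have h' (k : κ) : g (e k) = ∑ i, ⟪b i, e k⟫_ℝ * g (b i) := by
    conv_lhs => rw [← b.sum_repr' (e k)]
    simp
  simp only [h, h', Finset.sum_mul, Finset.mul_sum]
  rw [Finset.sum_comm]
  refine Finset.sum_congr rfl fun k _ ↦ Finset.sum_congr rfl fun i _ ↦ ?_
  rw [real_inner_comm]
  ring

theorem sharp_innerSL (v : V) : sharp (innerSL ℝ v) = v :=
  ext_inner_right ℝ fun w ↦ by rw [inner_sharp, innerSL_apply_apply]

theorem innerSL_sharp (γ : V →L[ℝ] ℝ) : innerSL ℝ (sharp γ) = γ := by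
  ext w
  rw [innerSL_apply_apply, inner_sharp]

theorem wedge_innerSL_apply (a b w : V) :
    wedge (innerSL ℝ a) b w = ⟪a, w⟫_ℝ • b - ⟪b, w⟫_ℝ • a := by
  simp [wedge, sharp_innerSL]

theorem inner_comp_orthonormalBasis {ι : Type*} [Fintype ι] (e : OrthonormalBasis ι ℝ V)
    (A B : V →L[ℝ] V) (u w : V) :
    ⟪A (B u), w⟫_ℝ = ∑ m, ⟪B u, e m⟫_ℝ * ⟪A (e m), w⟫_ℝ := by
  conv_lhs => rw [← e.sum_repr' (B u)]
  simp only [map_sum, map_smul, sum_inner, inner_smul_left, RCLike.conj_to_real]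
  exact Finset.sum_congr rfl fun m _ ↦ by rw [real_inner_comm]

theorem clm_ext_orthonormalBasis {ι : Type*} [Fintype ι] (e : OrthonormalBasis ι ℝ V)
    {A B : V →L[ℝ] V} (h : ∀ k l, ⟪A (e k), e l⟫_ℝ = ⟪B (e k), e l⟫_ℝ) : A = B := by
  refine ContinuousLinearMap.coe_injective (e.toBasis.ext fun k ↦ ?_)
  refine InnerProductSpace.ext_inner_right_basis e.toBasis fun l ↦ ?_
  simpa using h k l

theorem skew_of_orthonormalBasis {ι : Type*} [Fintype ι] (e : OrthonormalBasis ι ℝ V)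
    {A : V →L[ℝ] V} (h : ∀ k l, ⟪A (e k), e l⟫_ℝ = -⟪A (e l), e k⟫_ℝ) (u v : V) :
    ⟪A u, v⟫_ℝ = -⟪u, A v⟫_ℝ := by
  have h' : A = -(ContinuousLinearMap.adjoint A) := by
    refine clm_ext_orthonormalBasis e fun k l ↦ ?_
    rw [neg_apply, inner_neg_left, ContinuousLinearMap.adjoint_inner_left,
      real_inner_comm (A (e l)), h]
  conv_lhs => rw [h']
  rw [neg_apply, inner_neg_left, ContinuousLinearMap.adjoint_inner_left]

theorem wedge_skew (γ : V →L[ℝ] ℝ) (a u v : V) : ⟪wedge γ a u, v⟫_ℝ = -⟪u, wedge γ a v⟫_ℝ := by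
  rw [← innerSL_sharp γ, wedge_innerSL_apply, wedge_innerSL_apply]
  simp only [inner_sub_left, inner_sub_right, inner_smul_left, inner_smul_right,
    RCLike.conj_to_real, real_inner_comm u]
  ring

theorem wedge_add_right (γ : V →L[ℝ] ℝ) (a b : V) : wedge γ (a + b) = wedge γ a + wedge γ b := by
  rw [← innerSL_sharp γ]
  ext w
  simp only [add_apply, wedge_innerSL_apply, inner_add_left]
  module

theorem wedge_sub_right (γ : V →L[ℝ] ℝ) (a b : V) : wedge γ (a - b) = wedge γ a - wedge γ b := by
  rw [eq_sub_iff_add_eq, ← wedge_add_right, sub_add_cancel]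

theorem wedge_smul_left (c : ℝ) (γ : V →L[ℝ] ℝ) (a : V) : wedge (c • γ) a = c • wedge γ a := by
  ext w
  simp only [wedge, sub_apply, smul_apply, ContinuousLinearMap.smulRight_apply, map_smul]
  module

/-- A map which is skew with respect to the inner product is linear. -/
noncomputable def skewMap (f : V → V) (hf : ∀ u v, ⟪f u, v⟫_ℝ = -⟪u, f v⟫_ℝ) : V →L[ℝ] V :=
  LinearMap.toContinuousLinearMap
    { toFun := f
      map_add' := fun u v ↦ ext_inner_right ℝ fun w ↦ by
        rw [hf, inner_add_left, inner_add_left, hf, hf]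
        ring
      map_smul' := fun c u ↦ ext_inner_right ℝ fun w ↦ by
        simp only [hf, inner_smul_left, RingHom.id_apply, RCLike.conj_to_real]
        ring }

theorem skewMap_apply (f : V → V) (hf : ∀ u v, ⟪f u, v⟫_ℝ = -⟪u, f v⟫_ℝ) (u : V) :
    skewMap f hf u = f u :=
  rfl

variable [Fact (Module.finrank ℝ V = 4)] (o : Orientation ℝ V (Fin 4))

theorem inner_hodgeStarEnd (A : V →L[ℝ] V) (u v : V) :
    ⟪hodgeStarEnd o A u, v⟫_ℝ = hodgeStar o (fun a b ↦ ⟪A a, b⟫_ℝ) u v := by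
  -- The right-hand side is linear in `v`.
  obtain ⟨L, hL⟩ : ∃ L : V →ₗ[ℝ] ℝ, ∀ w, hodgeStar o (fun a b ↦ ⟪A a, b⟫_ℝ) u w = L w := by
    refine ⟨∑ i, ∑ j, ((1 / 2) * ⟪A (stdOrthonormalBasis ℝ V i), stdOrthonormalBasis ℝ V j⟫_ℝ) •
        o.volumeForm.toMultilinearMap.toLinearMap
          ![stdOrthonormalBasis ℝ V i, stdOrthonormalBasis ℝ V j, u, 0] 3, fun w ↦ ?_⟩
    have h' (a b : V) : Function.update ![a, b, u, 0] 3 w = ![a, b, u, w] := by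
      ext i; fin_cases i <;> rfl
    simp [hodgeStar, h', Finset.mul_sum, mul_assoc]
  conv_rhs => rw [hL, ← (stdOrthonormalBasis ℝ V).sum_repr' v, map_sum]
  simp [hodgeStarEnd, sum_inner, inner_smul_left, hL, mul_comm]

theorem asdForm_inner (A : V →L[ℝ] V) (u v : V) :
    asdForm o (fun a b ↦ ⟪A a, b⟫_ℝ) u v = ⟪asdEnd o A u, v⟫_ℝ := by
  simp [asdForm, asdEnd, inner_smul_left, inner_sub_left, inner_hodgeStarEnd]

theorem hodgeStar_orthonormalBasis (e : OrthonormalBasis (Fin 4) ℝ V) (A : V →L[ℝ] V) (u v : V) :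
    hodgeStar o (fun a b ↦ ⟪A a, b⟫_ℝ) u v =
      (1 / 2) * ∑ i, ∑ j, ⟪A (e i), e j⟫_ℝ * o.volumeForm ![e i, e j, u, v] := by
  have h1 (a b : V) : Function.update ![a, 0, u, v] 1 b = ![a, b, u, v] := by
    ext i; fin_cases i <;> rfl
  have h0 (a b : V) : Function.update ![0, b, u, v] 0 a = ![a, b, u, v] := by
    ext i; fin_cases i <;> rfl
  have key1 (a : V) := sum_mul_orthonormalBasis (stdOrthonormalBasis ℝ V) e
    (innerSL ℝ (A a)).toLinearMap (o.volumeForm.toMultilinearMap.toLinearMap ![a, 0, u, v] 1)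
  have key0 (b : V) : ∑ i, ⟪A (stdOrthonormalBasis ℝ V i), b⟫_ℝ *
      o.volumeForm ![stdOrthonormalBasis ℝ V i, b, u, v] =
      ∑ i, ⟪A (e i), b⟫_ℝ * o.volumeForm ![e i, b, u, v] := by
    simpa [h0, real_inner_comm b] using sum_mul_orthonormalBasis (stdOrthonormalBasis ℝ V) e
      ((innerSL ℝ b).comp A).toLinearMap
      (o.volumeForm.toMultilinearMap.toLinearMap ![0, b, u, v] 0)
  simp [h1] at key1
  rw [hodgeStar]
  simp only [key1]
  rw [Finset.sum_comm]
  simp only [key0]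
  rw [Finset.sum_comm]

theorem volumeForm_orthonormalBasis (e : OrthonormalBasis (Fin 4) ℝ V)
    (he : e.toBasis.orientation = o) (i j k l : Fin 4) :
    o.volumeForm ![e i, e j, e k, e l] = leviCivitaSymbol i j k l := by
  rw [o.volumeForm_robust e he, ← det_indicator_eq_leviCivitaSymbol, Module.Basis.det_apply,
    ← Matrix.det_transpose]
  congr 1
  ext a b
  have h : ![e i, e j, e k, e l] a = e (![i, j, k, l] a) := by fin_cases a <;> rfl
  simp [Module.Basis.toMatrix_apply, h, eq_comm]

/-- The matrix of the antiselfdual part in an oriented orthonormal basis. -/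
theorem inner_asdEnd (e : OrthonormalBasis (Fin 4) ℝ V) (he : e.toBasis.orientation = o)
    (A : V →L[ℝ] V) (k l : Fin 4) :
    ⟪asdEnd o A (e k), e l⟫_ℝ = asdMatrix (fun i j ↦ ⟪A (e i), e j⟫_ℝ) k l := by
  rw [← asdForm_inner, asdForm, hodgeStar_orthonormalBasis o e]
  simp only [volumeForm_orthonormalBasis o e he, asdMatrix]

/-- There is an orthonormal basis inducing the given orientation. -/
theorem exists_orthonormalBasis_orientation :
    ∃ e : OrthonormalBasis (Fin 4) ℝ V, e.toBasis.orientation = o :=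
  ⟨o.finOrthonormalBasis (by norm_num) Fact.out, o.finOrthonormalBasis_orientation ..⟩

theorem asdEnd_add (A B : V →L[ℝ] V) : asdEnd o (A + B) = asdEnd o A + asdEnd o B := by
  obtain ⟨e, he⟩ := exists_orthonormalBasis_orientation o
  refine clm_ext_orthonormalBasis e fun k l ↦ ?_
  simp only [add_apply, inner_add_left, inner_asdEnd o e he, asdMatrix_add]

theorem asdEnd_smul (c : ℝ) (A : V →L[ℝ] V) : asdEnd o (c • A) = c • asdEnd o A := by
  obtain ⟨e, he⟩ := exists_orthonormalBasis_orientation o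
  refine clm_ext_orthonormalBasis e fun k l ↦ ?_
  simp only [smul_apply, inner_smul_left, inner_asdEnd o e he, asdMatrix, mul_assoc,
    ← Finset.mul_sum, RCLike.conj_to_real]
  ring

theorem asdEnd_sub (A B : V →L[ℝ] V) : asdEnd o (A - B) = asdEnd o A - asdEnd o B := by
  rw [sub_eq_add_neg, ← neg_one_smul ℝ B, asdEnd_add, asdEnd_smul, neg_one_smul, ← sub_eq_add_neg]

theorem asdEnd_skew {A : V →L[ℝ] V} (hA : ∀ u v, ⟪A u, v⟫_ℝ = -⟪u, A v⟫_ℝ) (u v : V) :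
    ⟪asdEnd o A u, v⟫_ℝ = -⟪u, asdEnd o A v⟫_ℝ := by
  obtain ⟨e, he⟩ := exists_orthonormalBasis_orientation o
  refine skew_of_orthonormalBasis e (fun k l ↦ ?_) u v
  rw [inner_asdEnd o e he, inner_asdEnd o e he]
  exact asdMatrix_skew (fun i j ↦ by rw [hA, real_inner_comm]) k l

theorem asdEnd_asdEnd {A : V →L[ℝ] V} (hA : ∀ u v, ⟪A u, v⟫_ℝ = -⟪u, A v⟫_ℝ) :
    asdEnd o (asdEnd o A) = asdEnd o A := by
  obtain ⟨e, he⟩ := exists_orthonormalBasis_orientation o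
  refine clm_ext_orthonormalBasis e fun k l ↦ ?_
  simp only [inner_asdEnd o e he]
  exact asdMatrix_asdMatrix (fun i j ↦ by rw [hA, real_inner_comm]) k l

/-- Taking antiselfdual parts is equivariant under the action of skew endomorphisms. -/
theorem asdEnd_commutator {S : V →L[ℝ] V} (hS : ∀ u v, ⟪S u, v⟫_ℝ = -⟪u, S v⟫_ℝ)
    (A : V →L[ℝ] V) :
    asdEnd o (S ∘L A - A ∘L S) = S ∘L asdEnd o A - asdEnd o A ∘L S := by
  obtain ⟨e, he⟩ := exists_orthonormalBasis_orientation o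
  refine clm_ext_orthonormalBasis e fun k l ↦ ?_
  rw [inner_asdEnd o e he]
  simp only [sub_apply, ContinuousLinearMap.comp_apply, inner_sub_left,
    inner_comp_orthonormalBasis e, inner_asdEnd o e he]
  exact asdMatrix_commutator _ _ (fun i j ↦ by rw [hS, real_inner_comm]) k l

/-- Selfdual and antiselfdual endomorphisms commute. -/
theorem comp_comm_of_asdEnd_eq_zero {N P : V →L[ℝ] V} (hN : ∀ u v, ⟪N u, v⟫_ℝ = -⟪u, N v⟫_ℝ)
    (hN' : asdEnd o N = 0) (hP : IsAntiselfdualEnd o P) : N ∘L P = P ∘L N := by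
  obtain ⟨e, he⟩ := exists_orthonormalBasis_orientation o
  refine clm_ext_orthonormalBasis e fun k l ↦ ?_
  simp only [ContinuousLinearMap.comp_apply, inner_comp_orthonormalBasis e]
  refine commute_of_asdMatrix (fun i j ↦ ⟪N (e i), e j⟫_ℝ) (fun i j ↦ ⟪P (e i), e j⟫_ℝ)
    (fun i j ↦ by rw [hN, real_inner_comm]) (fun i j ↦ by rw [hP.1, real_inner_comm])
    (fun i j ↦ ?_) (fun i j ↦ ?_) k l
  · rw [← inner_asdEnd o e he, hN']
    simp
  · rw [← inner_asdEnd o e he, hP.2]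

/-- The algebraic step which turns the integrability condition of the twistor equation into the
Killing equation. -/
theorem skew_of_asdEnd_wedge_eq_zero {C : V →L[ℝ] V}
    (h : ∀ u v, asdEnd o (wedge (innerSL ℝ (C u)) v - wedge (innerSL ℝ (C v)) u) = 0) :
    (∀ u v, ⟪C u, v⟫_ℝ = -⟪u, C v⟫_ℝ) ∧ asdEnd o C = 0 := by
  obtain ⟨e, he⟩ := exists_orthonormalBasis_orientation o
  obtain ⟨h1, h2⟩ := skew_of_asdMatrix_eq_zero (fun i j ↦ ⟪C (e i), e j⟫_ℝ) fun u v k l ↦ by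
    have := congrArg (fun T : V →L[ℝ] V ↦ ⟪T (e k), e l⟫_ℝ) (h (e u) (e v))
    simpa only [inner_asdEnd o e he, sub_apply, wedge_innerSL_apply, inner_sub_left,
      inner_smul_left, orthonormal_iff_ite.1 e.orthonormal, zero_apply, inner_zero_left,
      RCLike.conj_to_real] using this
  refine ⟨skew_of_orthonormalBasis e h1, ?_⟩
  refine clm_ext_orthonormalBasis e fun k l ↦ ?_
  rw [inner_asdEnd o e he, h2]
  simp

/-- If the curvature operators `R u v` have the antiselfdual part of constant curvature `σ`, and
the commutator of `R u v` with an antiselfdual `P` is the antiselfdual part of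
`B u ∧ v + u ∧ B v`, then `B` is skew and its antiselfdual part is `σ P`. -/
theorem skew_of_curvature_commutator {R : V → V → V →L[ℝ] V} {B P : V →L[ℝ] V} {σ : ℝ}
    (hP : IsAntiselfdualEnd o P) (hR : ∀ u v a b, ⟪R u v a, b⟫_ℝ = -⟪a, R u v b⟫_ℝ)
    (hR' : ∀ u v, asdEnd o (R u v) = σ • asdEnd o (wedge (innerSL ℝ v) u))
    (hB : ∀ u v, R u v ∘L P - P ∘L R u v =
      asdEnd o (wedge (innerSL ℝ (B u)) v - wedge (innerSL ℝ (B v)) u)) :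
    (∀ u v, ⟪B u, v⟫_ℝ = -⟪u, B v⟫_ℝ) ∧ asdEnd o B = σ • P := by
  have h : ∀ u v, asdEnd o (wedge (innerSL ℝ ((B - σ • P) u)) v -
      wedge (innerSL ℝ ((B - σ • P) v)) u) = 0 := by
    intro u v
    set Q : V →L[ℝ] V := wedge (innerSL ℝ v) u with hQ
    -- Only the antiselfdual part of `R u v` contributes to the commutator with `P`.
    have hN := comp_comm_of_asdEnd_eq_zero o (N := R u v - σ • Q) (P := P)
      (fun a b ↦ by
        simp only [sub_apply, smul_apply, inner_sub_left, inner_sub_right, inner_smul_left,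
          inner_smul_right, hR u v a b, hQ, wedge_skew _ _ a b, RCLike.conj_to_real]
        ring)
      (by rw [asdEnd_sub, asdEnd_smul, hR', sub_self]) hP
    have h1 : R u v ∘L P - P ∘L R u v = σ • (Q ∘L P - P ∘L Q) := by
      ext w
      have := congrArg (fun T : V →L[ℝ] V ↦ T w) hN
      simp only [ContinuousLinearMap.comp_apply, sub_apply, smul_apply, map_sub, map_smul] at this ⊢
      rw [sub_eq_sub_iff_add_eq_add] at this
      rw [sub_eq_iff_eq_add, eq_sub_of_add_eq this]
      module
    have h2 : Q ∘L P - P ∘L Q = wedge (innerSL ℝ (P u)) v - wedge (innerSL ℝ (P v)) u := by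
      ext w
      simp only [ContinuousLinearMap.comp_apply, sub_apply, hQ, wedge_innerSL_apply, map_sub,
        map_smul, hP.1]
      module
    have h3 : asdEnd o (Q ∘L P - P ∘L Q) = Q ∘L P - P ∘L Q := by
      rw [asdEnd_commutator o (wedge_skew _ _), hP.2]
    have h4 : wedge (innerSL ℝ ((B - σ • P) u)) v - wedge (innerSL ℝ ((B - σ • P) v)) u =
        (wedge (innerSL ℝ (B u)) v - wedge (innerSL ℝ (B v)) u) - σ • (Q ∘L P - P ∘L Q) := by
      rw [h2]
      ext w
      simp only [sub_apply, smul_apply, wedge_innerSL_apply, inner_sub_left, inner_smul_left,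
        RCLike.conj_to_real]
      module
    rw [h4, asdEnd_sub, asdEnd_smul, h3, ← hB, h1, sub_self]
  obtain ⟨h1, h2⟩ := skew_of_asdEnd_wedge_eq_zero o h
  constructor
  · intro u v
    have := h1 u v
    simp only [sub_apply, smul_apply, inner_sub_left, inner_sub_right, inner_smul_left,
      inner_smul_right, RCLike.conj_to_real, hP.1 u v] at this
    linarith
  · rw [asdEnd_sub, asdEnd_smul, hP.2] at h2
    exact sub_eq_zero.1 h2

end LinearAlgebra

section SmoothFields

variable {E : Type*} [NormedAddCommGroup E] [NormedSpace ℝ E] [FiniteDimensional ℝ E]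
  {H : Type*} [TopologicalSpace H] {I : ModelWithCorners ℝ E H}
  {M : Type*} [TopologicalSpace M] [ChartedSpace H M] [IsManifold I ∞ M]
  [RiemannianBundle (fun x : M ↦ TangentSpace I x)]
  [IsContMDiffRiemannianBundle I ∞ E (fun x : M ↦ TangentSpace I x)]

/-! ### Smooth vector fields -/

theorem eventually_mdifferentiableAt {X : ∀ x : M, TangentSpace I x} {x : M}
    (hX : CMDiffAt ∞ (T% X) x) : ∀ᶠ y in nhds x, MDiffAt (T% X) y :=
  ((contMDiffAt_iff_contMDiffAt_nhds (n := 1) (by simp)).1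
    (hX.of_le (by simp))).mono fun _ hy ↦ hy.mdifferentiableAt one_ne_zero

theorem eventually_mdifferentiableAt_function {f : M → ℝ} {x : M}
    (hf : CMDiffAt ∞ f x) : ∀ᶠ y in nhds x, MDiffAt f y :=
  ((contMDiffAt_iff_contMDiffAt_nhds (n := 1) (by simp)).1
    (hf.of_le (by simp))).mono fun _ hy ↦ hy.mdifferentiableAt one_ne_zero

theorem contMDiffAt_inner {X Y : ∀ x : M, TangentSpace I x} {x : M}
    (hX : CMDiffAt ∞ (T% X) x) (hY : CMDiffAt ∞ (T% Y) x) :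
    CMDiffAt ∞ (fun y ↦ ⟪X y, Y y⟫_ℝ) x :=
  ContMDiffAt.inner_bundle (IB := I) (F := E) (E := fun x : M ↦ TangentSpace I x) hX hY

theorem contMDiffAt_mlieBracket {X Y : ∀ x : M, TangentSpace I x} {x : M}
    (hX : CMDiffAt ∞ (T% X) x) (hY : CMDiffAt ∞ (T% Y) x) :
    CMDiffAt ∞ (T% (VectorField.mlieBracket I X Y)) x := by
  have : IsManifold I (((⊤ : ℕ∞) : ℕ∞ω) + 1) M := by
    change IsManifold I ∞ M
    infer_instance
  have : IsManifold I (minSmoothness ℝ 2) M := by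
    rw [minSmoothness_of_isRCLikeNormedField]
    infer_instance
  have : IsManifold I (minSmoothness ℝ 3) M := by
    rw [minSmoothness_of_isRCLikeNormedField]
    infer_instance
  exact ContMDiffAt.mlieBracket_vectorField (m := ⊤) (n := ⊤) hX hY (by simp)

theorem mvfderiv_congr {f g : M → ℝ} {x : M} (h : ∀ᶠ y in nhds x, f y = g y) :
    mvfderiv I f x = mvfderiv I g x := by
  have h' : f =ᶠ[nhds x] g := h
  ext v
  simp only [mvfderiv, ContinuousLinearMap.comp_apply, h'.mfderiv_eq]
  rfl

/-- The Leibniz rule for the Lie bracket, solved for the derivative of the function. -/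
theorem mvfderiv_eq_of_leibniz {X W : ∀ x : M, TangentSpace I x} {f : M → ℝ} {x : M}
    (hf : MDiffAt f x) (hW : MDiffAt (T% W) x) :
    mvfderiv I f x (X x) * ⟪W x, W x⟫_ℝ =
      ⟪VectorField.mlieBracket I X (f • W) x - f x • VectorField.mlieBracket I X W x, W x⟫_ℝ := by
  rw [VectorField.mlieBracket_smul_right hf hW, add_sub_cancel_right, inner_smul_left]
  simp

/-- The derivative of a smooth function along a smooth vector field is smooth. -/
theorem contMDiffAt_mvfderiv {X : ∀ x : M, TangentSpace I x} {f : M → ℝ} {x : M}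
    (hf : CMDiffAt ∞ f x) (hX : CMDiffAt ∞ (T% X) x) :
    CMDiffAt ∞ (fun y ↦ mvfderiv I f y (X y)) x := by
  by_cases h : ∃ w : TangentSpace I x, w ≠ 0
  · -- Solve the Leibniz rule `[X, f W] = (X f) W + f [X, W]` for `X f`, with `W` nonzero near `x`.
    obtain ⟨w, hw⟩ := h
    have hW : CMDiffAt ∞ (T% (FiberBundle.extend E w)) x := FiberBundle.contMDiffAt_extend ..
    have hWW := contMDiffAt_inner hW hW
    have hne : ⟪FiberBundle.extend E w x, FiberBundle.extend E w x⟫_ℝ ≠ 0 := by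
      simpa using hw
    have h1 := contMDiffAt_inner ((contMDiffAt_mlieBracket hX (hf.smul_section hW)).sub_section
      (hf.smul_section (contMDiffAt_mlieBracket hX hW))) hW
    refine (h1.div₀ hWW hne).congr_of_eventuallyEq ?_
    filter_upwards [eventually_mdifferentiableAt hW, eventually_mdifferentiableAt_function hf,
      hWW.continuousAt.eventually_ne hne] with y hy hy' hy''
    rw [Pi.div_apply, eq_div_iff hy'', mvfderiv_eq_of_leibniz hy' hy]
    rfl
  · push Not at h
    refine (contMDiffAt_const (c := (0 : ℝ))).congr_of_eventuallyEq (Filter.Eventually.of_forall ?_)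
    intro y
    have hE : Subsingleton E := ⟨fun a b ↦ (h a).trans (h b).symm⟩
    have hy : Subsingleton (TangentSpace I y) := hE
    simp [Subsingleton.elim (X y) 0]

/-- The Lie bracket is the commutator of derivations. This follows from the Jacobi identity for the
fields `U`, `V`, `f W` where `W` does not vanish at the point considered. -/
theorem mvfderiv_commutator {U V : ∀ x : M, TangentSpace I x} {f : M → ℝ} {x : M}
    (hf : CMDiffAt ∞ f x) (hU : CMDiffAt ∞ (T% U) x) (hV : CMDiffAt ∞ (T% V) x) :
    mvfderiv I (fun y ↦ mvfderiv I f y (V y)) x (U x) -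
      mvfderiv I (fun y ↦ mvfderiv I f y (U y)) x (V x) =
      mvfderiv I f x (VectorField.mlieBracket I U V x) := by
  by_cases h : ∃ w : TangentSpace I x, w ≠ 0
  · obtain ⟨w, hw⟩ := h
    have hW : CMDiffAt ∞ (T% (FiberBundle.extend E w)) x := FiberBundle.contMDiffAt_extend ..
    set W : ∀ y : M, TangentSpace I y := FiberBundle.extend E w with hWdef
    have hWx : W x = w := by simp [hWdef]
    have : IsManifold I (minSmoothness ℝ 3) M := by
      rw [minSmoothness_of_isRCLikeNormedField]
      infer_instance
    have h2 : minSmoothness ℝ 2 ≤ (∞ : ℕ∞ω) := by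
      rw [minSmoothness_of_isRCLikeNormedField]
      exact ENat.LEInfty.out
    have jac1 := VectorField.leibniz_identity_mlieBracket_apply (hU.of_le h2) (hV.of_le h2)
      (hW.of_le h2)
    have jac2 := VectorField.leibniz_identity_mlieBracket_apply (hU.of_le h2) (hV.of_le h2)
      ((hf.smul_section hW).of_le h2)
    have hUf := contMDiffAt_mvfderiv hf hU
    have hVf := contMDiffAt_mvfderiv hf hV
    have hfd := hf.mdifferentiableAt (by simp)
    have hWd := hW.mdifferentiableAt (by simp)
    have hUW := contMDiffAt_mlieBracket hU hW
    have hVW := contMDiffAt_mlieBracket hV hW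
    -- The Leibniz rule for `[X, f W]` near `x`, and for its bracket with `Y` at `x`.
    have key {X Y : ∀ x : M, TangentSpace I x} (hX : CMDiffAt ∞ (T% X) x) :
        VectorField.mlieBracket I Y (VectorField.mlieBracket I X (f • W)) x =
          mvfderiv I (fun y ↦ mvfderiv I f y (X y)) x (Y x) • W x +
            mvfderiv I f x (X x) • VectorField.mlieBracket I Y W x +
            (mvfderiv I f x (Y x) • VectorField.mlieBracket I X W x +
              f x • VectorField.mlieBracket I Y (VectorField.mlieBracket I X W) x) := by
      have hXf := contMDiffAt_mvfderiv hf hX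
      have hXW := contMDiffAt_mlieBracket hX hW
      have e : VectorField.mlieBracket I X (f • W) =ᶠ[nhds x]
          (fun y ↦ mvfderiv I f y (X y)) • W + f • VectorField.mlieBracket I X W := by
        filter_upwards [eventually_mdifferentiableAt hW, eventually_mdifferentiableAt_function hf]
          with y hy hy'
        exact VectorField.mlieBracket_smul_right hy' hy
      rw [Filter.EventuallyEq.mlieBracket_vectorField_eq (Filter.EventuallyEq.refl (nhds x) Y) e,
        VectorField.mlieBracket_add_right
          ((hXf.smul_section hW).mdifferentiableAt (by simp))
          ((hf.smul_section hXW).mdifferentiableAt (by simp)),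
        VectorField.mlieBracket_smul_right (hXf.mdifferentiableAt (by simp)) hWd,
        VectorField.mlieBracket_smul_right hfd (hXW.mdifferentiableAt (by simp))]
    rw [key hV, key hU, VectorField.mlieBracket_smul_right hfd hWd, jac1, hWx] at jac2
    have : (mvfderiv I (fun y ↦ mvfderiv I f y (V y)) x (U x) -
      mvfderiv I (fun y ↦ mvfderiv I f y (U y)) x (V x) -
      mvfderiv I f x (VectorField.mlieBracket I U V x)) • w = 0 := by
      rw [sub_smul, sub_smul]
      have := sub_eq_zero.2 jac2
      rw [← this]
      simp only [smul_add]
      abel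
    rcases smul_eq_zero.1 this with h | h
    · linarith
    · exact absurd h hw
  · push Not at h
    simp [h (U x), h (V x), h (VectorField.mlieBracket I U V x)]

/-! ### Local orthonormal frames -/

theorem contMDiffAt_sum_smul {ι : Type*} [Fintype ι] {f : ι → M → ℝ}
    {e : ι → ∀ x : M, TangentSpace I x} {x : M} (hf : ∀ i, CMDiffAt ∞ (f i) x)
    (he : ∀ i, CMDiffAt ∞ (T% (e i)) x) :
    CMDiffAt ∞ (T% (fun y ↦ ∑ i, f i y • e i y)) x :=
  ContMDiffAt.sum_section (t := fun i y ↦ f i y • e i y) fun i _ ↦ (hf i).smul_section (he i)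

theorem contMDiffAt_gramSchmidt {n : ℕ} {s : Fin n → ∀ x : M, TangentSpace I x} {x : M}
    (hs : ∀ i, CMDiffAt ∞ (T% (s i)) x) (hx : LinearIndependent ℝ (fun i ↦ s i x)) (i : Fin n) :
    CMDiffAt ∞ (T% (fun y ↦ InnerProductSpace.gramSchmidt ℝ (fun j ↦ s j y) i)) x := by
  induction i using WellFoundedLT.induction with
  | ind i ih =>
    have h (j : Fin n) (hj : j ∈ Finset.Iio i) : CMDiffAt ∞ (T% (fun y ↦
        (⟪InnerProductSpace.gramSchmidt ℝ (fun j ↦ s j y) j, s i y⟫_ℝ /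
          ⟪InnerProductSpace.gramSchmidt ℝ (fun j ↦ s j y) j,
            InnerProductSpace.gramSchmidt ℝ (fun j ↦ s j y) j⟫_ℝ) •
          InnerProductSpace.gramSchmidt ℝ (fun j ↦ s j y) j)) x := by
      have hj' := ih j (Finset.mem_Iio.1 hj)
      refine ContMDiffAt.smul_section ?_ hj'
      refine (contMDiffAt_inner hj' (hs i)).div₀ (contMDiffAt_inner hj' hj') ?_
      simpa using InnerProductSpace.gramSchmidt_ne_zero j hx
    refine ((hs i).sub_section (ContMDiffAt.sum_section h)).congr_of_eventuallyEq
      (Filter.Eventually.of_forall fun y ↦ ?_)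
    have := InnerProductSpace.gramSchmidt_def'' ℝ (fun j ↦ s j y) i
    simp only [Pi.sub_apply, TotalSpace.mk_inj]
    rw [eq_sub_iff_add_eq]
    conv_rhs => rw [this]
    simp

variable (I) in
/-- Near every point there is a smooth orthonormal frame, obtained by applying the Gram-Schmidt
process to a local frame. -/
theorem exists_orthonormal_frame {n : ℕ} (hn : Module.finrank ℝ E = n) (x : M) :
    ∃ e : Fin n → ∀ y : M, TangentSpace I y, (∀ i, CMDiffAt ∞ (T% (e i)) x) ∧
      ∀ᶠ y in nhds x, ∃ b : OrthonormalBasis (Fin n) ℝ (TangentSpace I y), ∀ i, b i = e i y := by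
  let t := trivializationAt E (fun y : M ↦ TangentSpace I y) x
  let b := Module.finBasisOfFinrankEq ℝ E hn
  have hx : x ∈ t.baseSet := FiberBundle.mem_baseSet_trivializationAt' x
  let s : Fin n → ∀ y : M, TangentSpace I y := t.localFrame b
  have hs (i) : CMDiffAt ∞ (T% (s i)) x := contMDiffAt_localFrame_of_mem ∞ t b i hx
  have hli (y : M) (hy : y ∈ t.baseSet) : LinearIndependent ℝ (fun i ↦ s i y) :=
    (t.isLocalFrameOn_localFrame_baseSet I ∞ b).linearIndependent hy
  have hgs := contMDiffAt_gramSchmidt hs (hli x hx)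
  refine ⟨fun i y ↦ (1 / Real.sqrt ⟪InnerProductSpace.gramSchmidt ℝ (fun j ↦ s j y) i,
    InnerProductSpace.gramSchmidt ℝ (fun j ↦ s j y) i⟫_ℝ) •
      InnerProductSpace.gramSchmidt ℝ (fun j ↦ s j y) i, fun i ↦ ?_, ?_⟩
  · refine ContMDiffAt.smul_section ?_ (hgs i)
    have hpos : 0 < ⟪InnerProductSpace.gramSchmidt ℝ (fun j ↦ s j x) i,
        InnerProductSpace.gramSchmidt ℝ (fun j ↦ s j x) i⟫_ℝ :=
      real_inner_self_pos.2 (InnerProductSpace.gramSchmidt_ne_zero i (hli x hx))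
    refine contMDiffAt_const.div₀ ?_ (Real.sqrt_pos.2 hpos).ne'
    exact (Real.contDiffAt_sqrt hpos.ne').contMDiffAt.comp x (contMDiffAt_inner (hgs i) (hgs i))
  · filter_upwards [t.open_baseSet.mem_nhds hx] with y hy
    have ho := InnerProductSpace.gramSchmidtNormed_orthonormal (hli y hy)
    have hcard : Fintype.card (Fin n) = Module.finrank ℝ (TangentSpace I y) := by
      rw [Fintype.card_fin, ← hn]
      rfl
    refine ⟨OrthonormalBasis.mk ho
      (ho.linearIndependent.span_eq_top_of_card_eq_finrank' hcard).ge, fun i ↦ ?_⟩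
    simp [InnerProductSpace.gramSchmidtNormed]

/-- A vector field is smooth if its inner products with all smooth vector fields are smooth. -/
theorem contMDiffAt_of_inner {Z : ∀ x : M, TangentSpace I x} {x : M}
    (h : ∀ Y : ∀ x : M, TangentSpace I x, CMDiffAt ∞ (T% Y) x →
      CMDiffAt ∞ (fun y ↦ ⟪Y y, Z y⟫_ℝ) x) : CMDiffAt ∞ (T% Z) x := by
  obtain ⟨e, he, hb⟩ := exists_orthonormal_frame I rfl x
  refine (contMDiffAt_sum_smul (fun i ↦ h (e i) (he i)) he).congr_of_eventuallyEq ?_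
  filter_upwards [hb] with y ⟨b, hb⟩
  simp only [← hb, b.sum_repr']

theorem contMDiffAt_koszul {X Y Z : ∀ x : M, TangentSpace I x} {x : M}
    (hX : CMDiffAt ∞ (T% X) x) (hY : CMDiffAt ∞ (T% Y) x) (hZ : CMDiffAt ∞ (T% Z) x) :
    CMDiffAt ∞ (koszul I Y X Z) x :=
  (((((contMDiffAt_mvfderiv (contMDiffAt_inner hY hZ) hX).add
    (contMDiffAt_mvfderiv (contMDiffAt_inner hX hZ) hY)).sub
    (contMDiffAt_mvfderiv (contMDiffAt_inner hX hY) hZ)).add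
    (contMDiffAt_inner (contMDiffAt_mlieBracket hX hY) hZ)).sub
    (contMDiffAt_inner (contMDiffAt_mlieBracket hX hZ) hY)).sub
    (contMDiffAt_inner (contMDiffAt_mlieBracket hY hZ) hX)

/-- The covariant derivative `D_X Y` of smooth vector fields is smooth. -/
theorem contMDiffAt_leviCivita {X Y : ∀ x : M, TangentSpace I x} {x : M}
    (hX : CMDiffAt ∞ (T% X) x) (hY : CMDiffAt ∞ (T% Y) x) :
    CMDiffAt ∞ (T% (fun y ↦ leviCivita I Y y (X y))) x := by
  refine contMDiffAt_of_inner fun Z hZ ↦ ?_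
  refine ((contMDiffAt_koszul hX hY hZ).div_const 2).congr_of_eventuallyEq ?_
  filter_upwards [eventually_mdifferentiableAt hX, eventually_mdifferentiableAt hY,
    eventually_mdifferentiableAt hZ] with y hX' hY' hZ'
  rw [real_inner_comm]
  exact inner_leviCivitaAux I hY' hX' hZ'

/-! ### Rules for the Levi-Civita connection -/

theorem leviCivita_congr {Y Y' : ∀ x : M, TangentSpace I x} {x : M} (hY : MDiffAt (T% Y) x)
    (hY' : MDiffAt (T% Y') x) (h : ∀ᶠ y in nhds x, Y y = Y' y) :
    leviCivita I Y x = leviCivita I Y' x :=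
  (leviCivita I).isCovariantDerivativeOnUniv.congr_of_eventuallyEq hY hY' Filter.univ_mem h

theorem leviCivita_add {Y Y' : ∀ x : M, TangentSpace I x} {x : M} (hY : MDiffAt (T% Y) x)
    (hY' : MDiffAt (T% Y') x) :
    leviCivita I (fun y ↦ Y y + Y' y) x = leviCivita I Y x + leviCivita I Y' x :=
  (leviCivita I).isCovariantDerivativeOnUniv.add hY hY'

theorem leviCivita_smul {f : M → ℝ} {Y : ∀ x : M, TangentSpace I x} {x : M} (hf : MDiffAt f x)
    (hY : MDiffAt (T% Y) x) (u : TangentSpace I x) :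
    leviCivita I (fun y ↦ f y • Y y) x u = f x • leviCivita I Y x u + mvfderiv I f x u • Y x := by
  have := (leviCivita I).isCovariantDerivativeOnUniv.leibniz hY hf
  change leviCivita I (f • Y) x u = _
  rw [this]
  simp

theorem leviCivita_sub {Y Y' : ∀ x : M, TangentSpace I x} {x : M} (hY : MDiffAt (T% Y) x)
    (hY' : MDiffAt (T% Y') x) :
    leviCivita I (fun y ↦ Y y - Y' y) x = leviCivita I Y x - leviCivita I Y' x := by
  have h : MDiffAt (T% (fun y ↦ Y y - Y' y)) x := mdifferentiableAt_sub_section hY hY'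
  have := leviCivita_add h hY'
  simp only [sub_add_cancel] at this
  rw [this, add_sub_cancel_right]

theorem leviCivita_bracket {X Y : ∀ x : M, TangentSpace I x} {x : M} (hX : MDiffAt (T% X) x)
    (hY : MDiffAt (T% Y) x) :
    leviCivita I Y x (X x) - leviCivita I X x (Y x) = VectorField.mlieBracket I X Y x :=
  (CovariantDerivative.torsion_eq_zero_iff _).1 (leviCivita_torsion I) hX hY

theorem leviCivita_metric_vector {Y Z : ∀ x : M, TangentSpace I x} {x : M}
    (hY : MDiffAt (T% Y) x) (hZ : MDiffAt (T% Z) x) (u : TangentSpace I x) :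
    mvfderiv I (fun y ↦ ⟪Y y, Z y⟫_ℝ) x u =
      ⟪leviCivita I Y x u, Z x⟫_ℝ + ⟪Y x, leviCivita I Z x u⟫_ℝ := by
  simpa using leviCivita_metric I (X := FiberBundle.extend E u)
    (FiberBundle.mdifferentiableAt_extend ..) hY hZ

/-! ### Curvature -/

variable (I) in
/-- The curvature `D_U D_V Z - D_V D_U Z - D_[U,V] Z` of vector fields, before tensoriality. -/
noncomputable def fieldCurvature (U V Z : ∀ x : M, TangentSpace I x) (x : M) : TangentSpace I x :=
  leviCivita I (fun y ↦ leviCivita I Z y (V y)) x (U x)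
    - leviCivita I (fun y ↦ leviCivita I Z y (U y)) x (V x)
    - leviCivita I Z x (VectorField.mlieBracket I U V x)

/-- The curvature is skew in its last two arguments: commute derivatives of `⟪Z, W⟫`. -/
theorem inner_fieldCurvature {U V Z W : ∀ x : M, TangentSpace I x} {x : M}
    (hU : CMDiffAt ∞ (T% U) x) (hV : CMDiffAt ∞ (T% V) x) (hZ : CMDiffAt ∞ (T% Z) x)
    (hW : CMDiffAt ∞ (T% W) x) :
    ⟪fieldCurvature I U V Z x, W x⟫_ℝ = -⟪Z x, fieldCurvature I U V W x⟫_ℝ := by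
  have key {P Q : ∀ x : M, TangentSpace I x} (hP : CMDiffAt ∞ (T% P) x) :
      mvfderiv I (fun y ↦ mvfderiv I (fun z ↦ ⟪Z z, W z⟫_ℝ) y (P y)) x (Q x) =
        (⟪leviCivita I (fun y ↦ leviCivita I Z y (P y)) x (Q x), W x⟫_ℝ +
          ⟪leviCivita I Z x (P x), leviCivita I W x (Q x)⟫_ℝ) +
        (⟪leviCivita I Z x (Q x), leviCivita I W x (P x)⟫_ℝ +
          ⟪Z x, leviCivita I (fun y ↦ leviCivita I W y (P y)) x (Q x)⟫_ℝ) := by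
    have hPZ := contMDiffAt_leviCivita hP hZ
    have hPW := contMDiffAt_leviCivita hP hW
    rw [← leviCivita_metric_vector (hPZ.mdifferentiableAt (by simp))
        (hW.mdifferentiableAt (by simp)),
      ← leviCivita_metric_vector (hZ.mdifferentiableAt (by simp))
        (hPW.mdifferentiableAt (by simp)), ← add_apply,
      ← mvfderiv_fun_add ((contMDiffAt_inner hPZ hW).mdifferentiableAt (by simp))
        ((contMDiffAt_inner hZ hPW).mdifferentiableAt (by simp))]
    refine congrArg (· (Q x)) (mvfderiv_congr ?_)
    filter_upwards [eventually_mdifferentiableAt hZ, eventually_mdifferentiableAt hW] with y h1 h2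
    exact leviCivita_metric_vector h1 h2 _
  have h := mvfderiv_commutator (contMDiffAt_inner hZ hW) hU hV
  rw [key hV, key hU, leviCivita_metric_vector (hZ.mdifferentiableAt (by simp))
    (hW.mdifferentiableAt (by simp))] at h
  simp only [fieldCurvature, inner_sub_left, inner_sub_right]
  linarith

theorem fieldCurvature_extend {x : M} (u v : TangentSpace I x) {Z : ∀ x : M, TangentSpace I x}
    (hZ : CMDiffAt ∞ (T% Z) x) :
    fieldCurvature I (FiberBundle.extend E u) (FiberBundle.extend E v) Z x =
      riemann I x u v (Z x) := by
  -- Skewness shows that the curvature depends on `Z` only through `Z x`.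
  refine ext_inner_right ℝ fun w ↦ ?_
  have h1 := inner_fieldCurvature (FiberBundle.contMDiffAt_extend I E u)
    (FiberBundle.contMDiffAt_extend I E v) hZ (FiberBundle.contMDiffAt_extend I E w)
  have h2 := inner_fieldCurvature (FiberBundle.contMDiffAt_extend I E u)
    (FiberBundle.contMDiffAt_extend I E v) (FiberBundle.contMDiffAt_extend I E (Z x))
    (FiberBundle.contMDiffAt_extend I E w)
  simp only [FiberBundle.extend_apply_self] at h1 h2
  rw [h1, ← h2]
  simp [fieldCurvature, riemann]

theorem inner_riemann {x : M} (u v w z : TangentSpace I x) :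
    ⟪riemann I x u v w, z⟫_ℝ = -⟪w, riemann I x u v z⟫_ℝ := by
  have h := inner_fieldCurvature (FiberBundle.contMDiffAt_extend I E u)
    (FiberBundle.contMDiffAt_extend I E v) (FiberBundle.contMDiffAt_extend I E w)
    (FiberBundle.contMDiffAt_extend I E z)
  simpa [fieldCurvature, riemann] using h

theorem riemann_swap {x : M} (u v w : TangentSpace I x) :
    riemann I x u v w = -riemann I x v u w := by
  have h := VectorField.mlieBracket_swap_apply (I := I) (V := FiberBundle.extend E u)
    (W := FiberBundle.extend E v) (x := x)
  simp only [riemann, h, map_neg]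
  abel

theorem riemann_bianchi {x : M} (u v w : TangentSpace I x) :
    riemann I x u v w + riemann I x v w u + riemann I x w u v = 0 := by
  have hU := FiberBundle.contMDiffAt_extend (k := ∞) I E u
  have hV := FiberBundle.contMDiffAt_extend (k := ∞) I E v
  have hW := FiberBundle.contMDiffAt_extend (k := ∞) I E w
  have hUx := FiberBundle.extend_apply_self E u
  have hVx := FiberBundle.extend_apply_self E v
  have hWx := FiberBundle.extend_apply_self E w
  simp only [riemann]
  set U : ∀ y : M, TangentSpace I y := FiberBundle.extend E u
  set V : ∀ y : M, TangentSpace I y := FiberBundle.extend E v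
  set W : ∀ y : M, TangentSpace I y := FiberBundle.extend E w
  -- By torsion-freeness the cyclic sum is that of the double brackets.
  have key {P Q R : ∀ x : M, TangentSpace I x} (hP : CMDiffAt ∞ (T% P) x)
      (hQ : CMDiffAt ∞ (T% Q) x) (hR : CMDiffAt ∞ (T% R) x) :
      leviCivita I (fun y ↦ leviCivita I R y (Q y)) x (P x) -
        leviCivita I (fun y ↦ leviCivita I Q y (R y)) x (P x) -
        leviCivita I P x (VectorField.mlieBracket I Q R x) =
      VectorField.mlieBracket I P (VectorField.mlieBracket I Q R) x := by
    have hQR := contMDiffAt_leviCivita hQ hR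
    have hRQ := contMDiffAt_leviCivita hR hQ
    have hb := contMDiffAt_mlieBracket hQ hR
    rw [← leviCivita_bracket (hP.mdifferentiableAt (by simp)) (hb.mdifferentiableAt (by simp)),
      ← sub_apply, ← leviCivita_sub (hQR.mdifferentiableAt (by simp))
        (hRQ.mdifferentiableAt (by simp))]
    congr 2
    refine leviCivita_congr (hQR.sub_section hRQ |>.mdifferentiableAt (by simp))
      (hb.mdifferentiableAt (by simp)) ?_
    filter_upwards [eventually_mdifferentiableAt hQ, eventually_mdifferentiableAt hR] with y h1 h2
    exact leviCivita_bracket h1 h2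
  have h1 := key hU hV hW
  have h2 := key hV hW hU
  have h3 := key hW hU hV
  have : IsManifold I (minSmoothness ℝ 3) M := by
    rw [minSmoothness_of_isRCLikeNormedField]
    infer_instance
  have hm : minSmoothness ℝ 2 ≤ (∞ : ℕ∞ω) := by
    rw [minSmoothness_of_isRCLikeNormedField]
    exact ENat.LEInfty.out
  have jac := VectorField.leibniz_identity_mlieBracket_apply (hU.of_le hm) (hV.of_le hm)
    (hW.of_le hm)
  have s1 := VectorField.mlieBracket_swap_apply (I := I) (V := VectorField.mlieBracket I U V)
    (W := W) (x := x)
  have s2 : VectorField.mlieBracket I V (VectorField.mlieBracket I U W) x =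
      -VectorField.mlieBracket I V (VectorField.mlieBracket I W U) x := by
    rw [VectorField.mlieBracket_swap (V := U) (W := W)]
    have := VectorField.mlieBracket_const_smul_right (I := I) (V := V)
      (W := VectorField.mlieBracket I W U) (c := (-1 : ℝ)) (x := x)
      ((contMDiffAt_mlieBracket hW hU).mdifferentiableAt (by simp))
    simpa using this
  rw [s1, s2, ← h1, ← h2, ← h3, hUx, hVx, hWx] at jac
  have := sub_eq_zero.2 jac
  rw [← this]
  abel

/-- The pair symmetry of the curvature tensor. -/
theorem riemann_pair_symm {x : M} (u v w z : TangentSpace I x) :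
    ⟪riemann I x u v w, z⟫_ℝ = ⟪riemann I x w z u, v⟫_ℝ := by
  have sw (a b c d : TangentSpace I x) : ⟪riemann I x a b c, d⟫_ℝ = -⟪riemann I x b a c, d⟫_ℝ := by
    rw [riemann_swap, inner_neg_left]
  have sk (a b c d : TangentSpace I x) : ⟪riemann I x a b c, d⟫_ℝ = -⟪riemann I x a b d, c⟫_ℝ := by
    rw [inner_riemann, real_inner_comm]
  have bi (a b c d : TangentSpace I x) : ⟪riemann I x a b c, d⟫_ℝ + ⟪riemann I x b c a, d⟫_ℝ +
      ⟪riemann I x c a b, d⟫_ℝ = 0 := by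
    rw [← inner_add_left, ← inner_add_left, riemann_bianchi, inner_zero_left]
  linarith [bi u v w z, bi v w z u, bi w z u v, bi z u v w, sk u v w z, sk v w u z, sk w u v z,
    sk v w z u, sk w z v u, sk z v w u, sk w z u v, sk z u w v, sk u w z v, sk z u v w, sk u v z w,
    sk v z u w, sw w u v z, sw z v w u, sw u w z v, sw v z u w, sw v w u z, sw z u v w]

end SmoothFields

section EndomorphismFields

variable {E : Type*} [NormedAddCommGroup E] [NormedSpace ℝ E] [FiniteDimensional ℝ E]
  {H : Type*} [TopologicalSpace H] {I : ModelWithCorners ℝ E H}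
  {M : Type*} [TopologicalSpace M] [ChartedSpace H M] [IsManifold I ∞ M]
  [RiemannianBundle (fun x : M ↦ TangentSpace I x)]
  [IsContMDiffRiemannianBundle I ∞ E (fun x : M ↦ TangentSpace I x)]

/-! ### Skew endomorphism fields -/

/-- An endomorphism field is smooth at `x` if it maps vector fields smooth at `x` to such. -/
def IsSmoothEndAt (Ψ : ∀ x : M, TangentSpace I x →L[ℝ] TangentSpace I x) (x : M) : Prop :=
  ∀ V : ∀ x : M, TangentSpace I x, CMDiffAt ∞ (T% V) x → CMDiffAt ∞ (T% (fun y ↦ Ψ y (V y))) x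

/-- The endomorphism field is skew at every point. -/
def IsSkewField (Ψ : ∀ x : M, TangentSpace I x →L[ℝ] TangentSpace I x) : Prop :=
  ∀ (x : M) (u v : TangentSpace I x), ⟪Ψ x u, v⟫_ℝ = -⟪u, Ψ x v⟫_ℝ

variable {Ψ : ∀ x : M, TangentSpace I x →L[ℝ] TangentSpace I x}

/-- The derivative of a skew endomorphism field is skew, in terms of vector fields. -/
theorem IsSkewField.inner_covDeriv (hΨ : IsSkewField Ψ) {V W : ∀ x : M, TangentSpace I x} {x : M}
    (hV : MDiffAt (T% V) x) (hW : MDiffAt (T% W) x)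
    (hΨV : MDiffAt (T% (fun y ↦ Ψ y (V y))) x) (hΨW : MDiffAt (T% (fun y ↦ Ψ y (W y))) x)
    (u : TangentSpace I x) :
    ⟪leviCivita I (fun y ↦ Ψ y (V y)) x u - Ψ x (leviCivita I V x u), W x⟫_ℝ =
      -⟪V x, leviCivita I (fun y ↦ Ψ y (W y)) x u - Ψ x (leviCivita I W x u)⟫_ℝ := by
  have h1 := leviCivita_metric_vector hΨV hW u
  have h2 := leviCivita_metric_vector hV hΨW u
  have h3 : (fun y ↦ ⟪Ψ y (V y), W y⟫_ℝ) = -fun y ↦ ⟪V y, Ψ y (W y)⟫_ℝ :=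
    funext fun y ↦ hΨ y _ _
  rw [h3, mvfderiv_neg, neg_apply, h2] at h1
  have h4 := hΨ x (V x) (leviCivita I W x u)
  rw [inner_sub_left, inner_sub_right, hΨ x (leviCivita I V x u) (W x)]
  linarith

/-- The derivative of a skew endomorphism field may be computed with any extension of the vector. -/
theorem IsSkewField.covDerivEnd_apply (hΨ : IsSkewField Ψ) {x : M} (hs : IsSmoothEndAt Ψ x)
    {V : ∀ x : M, TangentSpace I x} (hV : MDiffAt (T% V) x)
    (hΨV : MDiffAt (T% (fun y ↦ Ψ y (V y))) x) (u : TangentSpace I x) :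
    covDerivEnd I Ψ x u (V x) =
      leviCivita I (fun y ↦ Ψ y (V y)) x u - Ψ x (leviCivita I V x u) := by
  have hext (v : TangentSpace I x) := FiberBundle.contMDiffAt_extend (k := ∞) I E v
  refine ext_inner_right ℝ fun w ↦ ?_
  have h1 := hΨ.inner_covDeriv hV ((hext w).mdifferentiableAt (by simp)) hΨV
    ((hs _ (hext w)).mdifferentiableAt (by simp)) u
  have h2 := hΨ.inner_covDeriv ((hext (V x)).mdifferentiableAt (by simp))
    ((hext w).mdifferentiableAt (by simp)) ((hs _ (hext (V x))).mdifferentiableAt (by simp))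
    ((hs _ (hext w)).mdifferentiableAt (by simp)) u
  simp only [FiberBundle.extend_apply_self] at h1 h2
  rw [h1, ← h2]
  rfl

theorem IsSkewField.inner_covDerivEnd (hΨ : IsSkewField Ψ) {x : M} (hs : IsSmoothEndAt Ψ x)
    (u v w : TangentSpace I x) :
    ⟪covDerivEnd I Ψ x u v, w⟫_ℝ = -⟪v, covDerivEnd I Ψ x u w⟫_ℝ := by
  have hext (v : TangentSpace I x) := FiberBundle.contMDiffAt_extend (k := ∞) I E v
  have h := hΨ.inner_covDeriv ((hext v).mdifferentiableAt (by simp))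
    ((hext w).mdifferentiableAt (by simp)) ((hs _ (hext v)).mdifferentiableAt (by simp))
    ((hs _ (hext w)).mdifferentiableAt (by simp)) u
  simp only [FiberBundle.extend_apply_self] at h
  exact h

/-- An endomorphism field which is smooth on vector fields is a smooth section of the
endomorphism bundle. -/
theorem IsSmoothEndAt.contMDiffAt {x : M} (hs : IsSmoothEndAt Ψ x) :
    ContMDiffAt I (I.prod 𝓘(ℝ, E →L[ℝ] E)) ∞ (fun y ↦ TotalSpace.mk' (E →L[ℝ] E)
      (E := fun y : M ↦ TangentSpace I y →L[ℝ] TangentSpace I y) y (Ψ y)) x := by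
  rw [contMDiffAt_hom_bundle]
  refine ⟨contMDiffAt_id, ?_⟩
  let b := Module.finBasis ℝ E
  let t := trivializationAt E (fun y : M ↦ TangentSpace I y) x
  have hx : x ∈ t.baseSet := FiberBundle.mem_baseSet_trivializationAt' x
  -- In coordinates, the columns of the matrix are the images of the coordinate fields.
  have hcol (i) : CMDiffAt ∞ (fun y ↦ (t ⟨y, Ψ y (t.symm y (b i))⟩).2) x := by
    have h := (contMDiffAt_section x).1 (hs _ (FiberBundle.contMDiffAt_extend I E (t.symm x (b i))))
    have hb : (t ⟨x, t.symm x (b i)⟩).2 = b i := by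
      rw [t.apply_mk_symm hx]
    have he : (FiberBundle.extend E (t.symm x (b i)) : ∀ y : M, TangentSpace I y) =
        fun y ↦ t.symm y (b i) := by
      funext y
      change t.symm y (t ⟨x, t.symm x (b i)⟩).2 = _
      rw [hb]
    rw [he] at h
    exact h
  have hsum : CMDiffAt ∞ (fun y ↦ ∑ i, ContinuousLinearMap.smulRightL ℝ E E
      (LinearMap.toContinuousLinearMap (b.coord i)) ((t ⟨y, Ψ y (t.symm y (b i))⟩).2)) x :=
    contMDiffAt_finsetSum fun i _ ↦
      (ContinuousLinearMap.contMDiff (ContinuousLinearMap.smulRightL ℝ E E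
        (LinearMap.toContinuousLinearMap (b.coord i)))).contMDiffAt.comp x (hcol i)
  refine hsum.congr_of_eventuallyEq ?_
  filter_upwards [t.open_baseSet.mem_nhds hx] with y hy
  refine ContinuousLinearMap.coe_injective (b.ext fun j ↦ ?_)
  have h : ContinuousLinearMap.inCoordinates E (TangentSpace I) E (TangentSpace I) x y x y (Ψ y)
      (b j) = (t ⟨y, Ψ y (t.symm y (b j))⟩).2 :=
    (t.continuousLinearMapAt_apply_of_mem ℝ hy (Ψ y (t.symmL ℝ y (b j)))).trans
      (by rw [t.symmL_apply hy])
  rw [ContinuousLinearMap.coe_coe, ContinuousLinearMap.coe_coe, h, sum_apply]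
  simp [Finsupp.single_apply, ite_smul]

/-! ### Killing fields -/

theorem IsKilling.isSkewField {K : ∀ x : M, TangentSpace I x} (hK : IsKilling I K) :
    IsSkewField (leviCivita I K) :=
  hK.2

theorem IsKilling.isSmoothEndAt {K : ∀ x : M, TangentSpace I x} (hK : IsKilling I K) (x : M) :
    IsSmoothEndAt (leviCivita I K) x :=
  fun _ hV ↦ contMDiffAt_leviCivita hV (hK.1 x)

/-- Kostant's identity `D²_{u,v} K = R_{u,K} v` for a Killing field `K`. -/
theorem IsKilling.covDerivEnd_leviCivita {K : ∀ x : M, TangentSpace I x} (hK : IsKilling I K)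
    (x : M) (u v : TangentSpace I x) :
    covDerivEnd I (leviCivita I K) x u v = riemann I x u (K x) v := by
  have skew (a b c : TangentSpace I x) :=
    hK.isSkewField.inner_covDerivEnd (hK.isSmoothEndAt x) a b c
  -- The Ricci identity for `K`.
  have comm (a b c : TangentSpace I x) : ⟪covDerivEnd I (leviCivita I K) x a b, c⟫_ℝ -
      ⟪covDerivEnd I (leviCivita I K) x b a, c⟫_ℝ = ⟪riemann I x a b (K x), c⟫_ℝ := by
    have hA := FiberBundle.contMDiffAt_extend (k := ∞) I E a
    have hB := FiberBundle.contMDiffAt_extend (k := ∞) I E b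
    have h := leviCivita_bracket (hA.mdifferentiableAt (by simp)) (hB.mdifferentiableAt (by simp))
    rw [← fieldCurvature_extend a b (hK.1 x), fieldCurvature, ← h, ← inner_sub_left]
    simp only [covDerivEnd, FiberBundle.extend_apply_self, map_sub]
    congr 1
    abel
  refine ext_inner_right ℝ fun w ↦ ?_
  have skew' (a b c : TangentSpace I x) : ⟪covDerivEnd I (leviCivita I K) x a b, c⟫_ℝ =
      -⟪covDerivEnd I (leviCivita I K) x a c, b⟫_ℝ := by
    rw [skew, real_inner_comm]
  have bi := congrArg (fun a ↦ ⟪a, w⟫_ℝ) (riemann_bianchi u v (K x))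
  simp only [inner_add_left, inner_zero_left] at bi
  have h1 := riemann_pair_symm v w (K x) u
  rw [riemann_swap (K x) u, inner_neg_left] at h1
  have h2 := riemann_pair_symm v (K x) u w
  rw [riemann_swap u w, inner_neg_left, inner_riemann w u, neg_neg,
    real_inner_comm (riemann I x w u (K x))] at h2
  rw [riemann_swap (K x) u, inner_neg_left] at bi
  -- A tensor which is skew in the last two arguments is determined, as in the Koszul formula, by
  -- its skew part in the first two.
  linarith [comm u v w, comm v w u, comm w u v, skew' u v w, skew' v u w, skew' w u v]

end EndomorphismFields

section Derivative

variable {E : Type*} [NormedAddCommGroup E] [NormedSpace ℝ E]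
  {H : Type*} [TopologicalSpace H] {I : ModelWithCorners ℝ E H}
  {M : Type*} [TopologicalSpace M] [ChartedSpace H M]

/-! ### Parallelism of the antiselfdual projection -/

theorem mvfderiv_sum_mul_const {ι : Type} (s : Finset ι) {f : ι → M → ℝ} {x : M}
    (hf : ∀ i ∈ s, MDiffAt (f i) x) (c : ι → ℝ) (u : TangentSpace I x) :
    mvfderiv I (fun y ↦ ∑ i ∈ s, f i y * c i) x u = ∑ i ∈ s, mvfderiv I (f i) x u * c i := by
  classical
  induction s using Finset.induction_on with
  | empty => simp [mvfderiv_const]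
  | insert i s hi ih =>
    have hmul (j) (hj : j ∈ insert i s) : MDiffAt (fun y ↦ f j y * c j) x :=
      (hf j hj).mul mdifferentiableAt_const
    have hsum : MDiffAt (fun y ↦ ∑ j ∈ s, f j y * c j) x := by
      have := MDifferentiableAt.sum (z := x) (t := s) (f := fun j y ↦ f j y * c j)
        fun j hj ↦ hmul j (Finset.mem_insert_of_mem hj)
      rwa [Finset.sum_fn] at this
    simp only [Finset.sum_insert hi]
    rw [mvfderiv_fun_add (hmul i (Finset.mem_insert_self i s)) hsum, add_apply,
      ih fun j hj ↦ hf j (Finset.mem_insert_of_mem hj),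
      mvfderiv_fun_mul (hf i (Finset.mem_insert_self i s)) mdifferentiableAt_const]
    simp [mvfderiv_const, mul_comm]

theorem asdMatrix_eq_sum (a : Fin 4 → Fin 4 → ℝ) (k l : Fin 4) : asdMatrix a k l =
    ∑ p : Fin 4 × Fin 4, a p.1 p.2 *
      ((if p = (k, l) then 1 / 2 else 0) - (1 / 4) * leviCivitaSymbol p.1 p.2 k l) := by
  simp only [mul_sub, Finset.sum_sub_distrib, mul_ite, mul_zero, Finset.sum_ite_eq',
    Finset.mem_univ, if_true, asdMatrix, Fintype.sum_prod_type, Finset.mul_sum]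
  congr 1
  · ring
  · exact Finset.sum_congr rfl fun i _ ↦ Finset.sum_congr rfl fun j _ ↦ by ring

theorem contMDiffAt_asdMatrix {a : M → Fin 4 → Fin 4 → ℝ} {x : M}
    (ha : ∀ i j, CMDiffAt ∞ (fun y ↦ a y i j) x) (k l : Fin 4) :
    CMDiffAt ∞ (fun y ↦ asdMatrix (a y) k l) x := by
  refine contMDiffAt_const.mul ((ha k l).sub (contMDiffAt_const.mul ?_))
  exact contMDiffAt_finsetSum fun i _ ↦ contMDiffAt_finsetSum fun j _ ↦
    (ha i j).mul contMDiffAt_const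

theorem mvfderiv_asdMatrix {a : M → Fin 4 → Fin 4 → ℝ} {x : M}
    (ha : ∀ i j, MDiffAt (fun y ↦ a y i j) x) (u : TangentSpace I x) (k l : Fin 4) :
    mvfderiv I (fun y ↦ asdMatrix (a y) k l) x u =
      asdMatrix (fun i j ↦ mvfderiv I (fun y ↦ a y i j) x u) k l := by
  simp only [asdMatrix_eq_sum]
  exact mvfderiv_sum_mul_const Finset.univ (f := fun (p : Fin 4 × Fin 4) y ↦ a y p.1 p.2)
    (fun p _ ↦ ha p.1 p.2) _ u

end Derivative

section FourManifold

variable {M : Type*} [TopologicalSpace M] [ChartedSpace (EuclideanSpace ℝ (Fin 4)) M]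
  [IsManifold (𝓡 4) ∞ M] [RiemannianBundle (fun x : M ↦ TangentSpace (𝓡 4) x)]
  [IsContMDiffRiemannianBundle (𝓡 4) ∞ (EuclideanSpace ℝ (Fin 4))
    (fun x : M ↦ TangentSpace (𝓡 4) x)]
  {o : ∀ x : M, Orientation ℝ (TangentSpace (𝓡 4) x) (Fin 4)}

/-- The vector field is smooth at `x`. -/
abbrev IsSmoothFieldAt (V : ∀ x : M, TangentSpace (𝓡 4) x) (x : M) : Prop :=
  ContMDiffAt (𝓡 4) (𝓡 4).tangent ∞ (fun y ↦ (⟨y, V y⟩ : TangentBundle (𝓡 4) M)) x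

/-- Near every point of an oriented manifold there is a smooth positively oriented orthonormal
frame. -/
theorem IsManifoldOrientation.exists_frame (ho : IsManifoldOrientation o) (x : M) :
    ∃ e : Fin 4 → ∀ y : M, TangentSpace (𝓡 4) y, (∀ i, IsSmoothFieldAt (e i) x) ∧
      ∀ᶠ y in nhds x, ∃ b : OrthonormalBasis (Fin 4) ℝ (TangentSpace (𝓡 4) y),
        (∀ i, b i = e i y) ∧ b.toBasis.orientation = o y := by
  -- A frame which is positively oriented at `x` is positively oriented near `x`.
  have key (e : Fin 4 → ∀ y : M, TangentSpace (𝓡 4) y) (he : ∀ i, IsSmoothFieldAt (e i) x)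
      (hb : ∀ᶠ y in nhds x, ∃ b : OrthonormalBasis (Fin 4) ℝ (TangentSpace (𝓡 4) y),
        ∀ i, b i = e i y) (hpos : 0 < (o x).volumeForm (fun i ↦ e i x)) :
      ∀ᶠ y in nhds x, ∃ b : OrthonormalBasis (Fin 4) ℝ (TangentSpace (𝓡 4) y),
        (∀ i, b i = e i y) ∧ b.toBasis.orientation = o y := by
    filter_upwards [hb, ho x e (fun i ↦ (he i).continuousAt) hpos] with y ⟨b, hb⟩ hy
    refine ⟨b, hb, ?_⟩
    by_contra hne
    have h := (o y).volumeForm_robust_neg b hne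
    rw [← funext hb] at hy
    rw [h] at hy
    have h1 : b.toBasis.det (fun i ↦ b i) = 1 := by
      rw [← b.coe_toBasis]
      exact b.toBasis.det_self
    rw [AlternatingMap.neg_apply, h1] at hy
    linarith
  obtain ⟨e, he, hb⟩ := exists_orthonormal_frame (𝓡 4) finrank_euclideanSpace_fin x
  by_cases hpos : 0 < (o x).volumeForm (fun i ↦ e i x)
  · exact ⟨e, he, key e he hb hpos⟩
  · -- Otherwise exchange the first two vectors of the frame.
    let σ : Equiv.Perm (Fin 4) := Equiv.swap 0 1
    refine ⟨fun i ↦ e (σ i), fun i ↦ he _, key _ (fun i ↦ he _) ?_ ?_⟩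
    · filter_upwards [hb] with y ⟨b, hb⟩
      exact ⟨b.reindex σ, fun i ↦ by simp [σ, hb]⟩
    · have h1 : (o x).volumeForm (fun i ↦ e (σ i) x) = -(o x).volumeForm (fun i ↦ e i x) :=
        (o x).volumeForm.map_swap (fun i ↦ e i x) (by decide : (0 : Fin 4) ≠ 1)
      have h2 : (o x).volumeForm (fun i ↦ e i x) ≠ 0 := by
        obtain ⟨b, hb⟩ := hb.self_of_nhds
        rw [← funext hb, ← abs_ne_zero, (o x).abs_volumeForm_apply_of_orthonormal b]
        exact one_ne_zero
      rw [h1]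
      exact neg_pos.2 (lt_of_le_of_ne (not_lt.1 hpos) h2)

variable {Ψ : ∀ x : M, TangentSpace (𝓡 4) x →L[ℝ] TangentSpace (𝓡 4) x}

theorem IsSkewField.isSkewField_asdEnd (hΨ : IsSkewField Ψ) :
    IsSkewField fun y ↦ asdEnd (o y) (Ψ y) :=
  fun y ↦ asdEnd_skew (o y) (hΨ y)

theorem IsSmoothEndAt.isSmoothEndAt_asdEnd (ho : IsManifoldOrientation o) {x : M}
    (hs : IsSmoothEndAt Ψ x) : IsSmoothEndAt (fun y ↦ asdEnd (o y) (Ψ y)) x := by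
  obtain ⟨e, he, hb⟩ := ho.exists_frame x
  intro V hV
  refine (contMDiffAt_sum_smul (f := fun l y ↦ ∑ k, ⟪V y, e k y⟫_ℝ *
    asdMatrix (fun i j ↦ ⟪Ψ y (e i y), e j y⟫_ℝ) k l) (fun l ↦ ?_) he).congr_of_eventuallyEq ?_
  · exact contMDiffAt_finsetSum fun k _ ↦ (contMDiffAt_inner hV (he k)).mul
      (contMDiffAt_asdMatrix (fun i j ↦ contMDiffAt_inner (hs _ (he i)) (he j)) k l)
  · filter_upwards [hb] with y ⟨b, hb, hor⟩
    simp only [← hb, ← inner_asdEnd (o y) b hor]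
    congr 1
    rw [← b.sum_repr' (asdEnd (o y) (Ψ y) (V y))]
    refine Finset.sum_congr rfl fun l _ ↦ congrArg (· • b l) ?_
    rw [real_inner_comm]
    exact inner_comp_orthonormalBasis b (asdEnd (o y) (Ψ y)) (ContinuousLinearMap.id ℝ _) (V y)
      (b l)

/-- In an orthonormal frame `e`, with `S` the skew endomorphism mapping `e k` to `D_u (e k)`, the
derivative of an endomorphism field is the derivative of its coefficients plus a commutator. -/
theorem IsSkewField.inner_covDerivEnd_frame {x : M} (hΨ : IsSkewField Ψ) (hs : IsSmoothEndAt Ψ x)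
    {e : Fin 4 → ∀ y : M, TangentSpace (𝓡 4) y} (he : ∀ i, IsSmoothFieldAt (e i) x)
    {S : TangentSpace (𝓡 4) x →L[ℝ] TangentSpace (𝓡 4) x} {u : TangentSpace (𝓡 4) x}
    (hS : ∀ v w, ⟪S v, w⟫_ℝ = -⟪v, S w⟫_ℝ) (hSe : ∀ k, S (e k x) = leviCivita (𝓡 4) (e k) x u)
    (k l : Fin 4) : ⟪covDerivEnd (𝓡 4) Ψ x u (e k x), e l x⟫_ℝ =
      mvfderiv (𝓡 4) (fun y ↦ ⟪Ψ y (e k y), e l y⟫_ℝ) x u +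
        ⟪(S ∘L Ψ x - Ψ x ∘L S) (e k x), e l x⟫_ℝ := by
  have hk := (he k).mdifferentiableAt (by simp)
  have hΨk := (hs _ (he k)).mdifferentiableAt (by simp)
  rw [hΨ.covDerivEnd_apply hs hk hΨk,
    leviCivita_metric_vector hΨk ((he l).mdifferentiableAt (by simp)), ← hSe, ← hSe]
  simp only [sub_apply, ContinuousLinearMap.comp_apply, inner_sub_left, hS (Ψ x (e k x))]
  ring

/-- The antiselfdual projection is parallel: it commutes with covariant differentiation. -/
theorem IsSkewField.covDerivEnd_asdEnd (ho : IsManifoldOrientation o) {x : M} (hΨ : IsSkewField Ψ)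
    (hs : IsSmoothEndAt Ψ x) {A : TangentSpace (𝓡 4) x →L[ℝ] TangentSpace (𝓡 4) x}
    {u : TangentSpace (𝓡 4) x} (hA : ∀ w, covDerivEnd (𝓡 4) Ψ x u w = A w)
    (w : TangentSpace (𝓡 4) x) :
    covDerivEnd (𝓡 4) (fun y ↦ asdEnd (o y) (Ψ y)) x u w =
      asdEnd (o x) A w := by
  obtain ⟨e, he, hb⟩ := ho.exists_frame x
  obtain ⟨b, hbe, hor⟩ := hb.self_of_nhds
  have hΦ := hΨ.isSkewField_asdEnd (o := o)
  have hsΦ := hs.isSmoothEndAt_asdEnd ho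
  -- The connection matrix of the frame, which is skew.
  let S : TangentSpace (𝓡 4) x →L[ℝ] TangentSpace (𝓡 4) x :=
    ∑ i, (innerSL ℝ (b i)).smulRight (leviCivita (𝓡 4) (e i) x u)
  have hSe (k) : S (b k) = leviCivita (𝓡 4) (e k) x u := by
    simp [S, sum_apply, orthonormal_iff_ite.1 b.orthonormal, ite_smul]
  have hS : ∀ v w, ⟪S v, w⟫_ℝ = -⟪v, S w⟫_ℝ := by
    refine skew_of_orthonormalBasis b fun k l ↦ ?_
    have h := leviCivita_metric_vector ((he k).mdifferentiableAt (by simp))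
      ((he l).mdifferentiableAt (by simp)) u
    have hconst : ∀ᶠ y in nhds x, ⟪e k y, e l y⟫_ℝ = if k = l then (1 : ℝ) else 0 := by
      filter_upwards [hb] with y ⟨b, hb, _⟩
      rw [← hb, ← hb, orthonormal_iff_ite.1 b.orthonormal]
    rw [mvfderiv_congr hconst, mvfderiv_const, zero_apply] at h
    rw [hSe, hSe, hbe, hbe, real_inner_comm (e k x)]
    linarith
  simp only [hbe] at hSe
  have hB : skewMap _ (hΦ.inner_covDerivEnd hsΦ u) = asdEnd (o x) A := by
    refine clm_ext_orthonormalBasis b fun k l ↦ ?_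
    have hcoeff : ∀ᶠ y in nhds x, ⟪asdEnd (o y) (Ψ y) (e k y), e l y⟫_ℝ =
        asdMatrix (fun i j ↦ ⟪Ψ y (e i y), e j y⟫_ℝ) k l := by
      filter_upwards [hb] with y ⟨b, hb, hor⟩
      simp only [← hb, ← inner_asdEnd (o y) b hor]
    rw [skewMap_apply, inner_asdEnd (o x) b hor]
    simp only [hbe, ← hA]
    simp only [hΨ.inner_covDerivEnd_frame hs he hS hSe]
    rw [hΦ.inner_covDerivEnd_frame hsΦ he hS hSe, mvfderiv_congr hcoeff,
      mvfderiv_asdMatrix fun i j ↦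
        (contMDiffAt_inner (hs _ (he i)) (he j)).mdifferentiableAt (by simp),
      ← asdEnd_commutator (o x) hS, asdMatrix_add]
    simp only [← hbe, inner_asdEnd (o x) b hor]
  rw [← hB, skewMap_apply]

/-! ### Curvature of selfdual Einstein manifolds -/

theorem scal_of_ricci {c : ℝ} {x : M}
    (hE : ∀ u v : TangentSpace (𝓡 4) x, ricci (𝓡 4) x u v = c * ⟪u, v⟫_ℝ) :
    scal (𝓡 4) x = 4 * c := by
  have h : Module.finrank ℝ (TangentSpace (𝓡 4) x) = 4 := Fact.out
  simp [scal, hE, h]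

/-- On a selfdual Einstein manifold the antiselfdual part of the curvature is that of a space of
constant curvature. -/
theorem IsSelfdual.asdEnd_riemann (hS : IsSelfdual o) {c : ℝ} {x : M}
    (hE : ∀ u v : TangentSpace (𝓡 4) x, ricci (𝓡 4) x u v = c * ⟪u, v⟫_ℝ)
    (u v : TangentSpace (𝓡 4) x) :
    asdEnd (o x) (skewMap (riemann (𝓡 4) x u v) (inner_riemann u v)) =
      (c / 3) • asdEnd (o x) (wedge (innerSL ℝ v) u) := by
  rw [← asdEnd_smul, ← sub_eq_zero, ← asdEnd_sub]
  have hscal := scal_of_ricci hE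
  have hw : weyl x u v = fun w z ↦
      ⟪(skewMap (riemann (𝓡 4) x u v) (inner_riemann u v) -
        (c / 3) • wedge (innerSL ℝ v) u) w, z⟫_ℝ := by
    funext w z
    simp only [weyl, hE, hscal, sub_apply, smul_apply, skewMap_apply, wedge_innerSL_apply,
      inner_sub_left, inner_smul_left, RCLike.conj_to_real]
    ring
  ext w
  refine ext_inner_right ℝ fun z ↦ ?_
  rw [← asdForm_inner, ← hw, hS]
  simp

end FourManifold

section OneForms

variable {E : Type*} [NormedAddCommGroup E] [NormedSpace ℝ E] [FiniteDimensional ℝ E]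
  {H : Type*} [TopologicalSpace H] {I : ModelWithCorners ℝ E H}
  {M : Type*} [TopologicalSpace M] [ChartedSpace H M] [IsManifold I ∞ M]
  [RiemannianBundle (fun x : M ↦ TangentSpace I x)]
  [IsContMDiffRiemannianBundle I ∞ E (fun x : M ↦ TangentSpace I x)]

/-! ### One-forms and vector fields -/

theorem contMDiffAt_innerSL {G : ∀ x : M, TangentSpace I x} {x : M} (hG : CMDiffAt ∞ (T% G) x) :
    ContMDiffAt I (I.prod 𝓘(ℝ, E →L[ℝ] ℝ)) ∞ (fun y ↦ TotalSpace.mk' (E →L[ℝ] ℝ)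
      (E := fun y : M ↦ TangentSpace I y →L[ℝ] ℝ) y (innerSL ℝ (G y))) x := by
  obtain ⟨g, hg, hg'⟩ := IsContMDiffRiemannianBundle.exists_contMDiff (IB := I) (n := ∞) (F := E)
    (E := fun x : M ↦ TangentSpace I x)
  have h (y : M) : g y (G y) = innerSL ℝ (G y) := by
    ext w
    exact (hg' y _ _).symm
  have := ContMDiffAt.clm_bundle_apply (IB := I) (F₁ := E) (F₂ := E →L[ℝ] ℝ)
    (E₁ := fun x : M ↦ TangentSpace I x) (E₂ := fun x : M ↦ TangentSpace I x →L[ℝ] ℝ)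
    (b := fun y : M ↦ y) (ϕ := g) (v := G) (hg x) hG
  simp only [h] at this
  exact this

theorem contMDiffAt_sharp {γ : ∀ x : M, TangentSpace I x →L[ℝ] ℝ} {x : M}
    (hγ : ContMDiffAt I (I.prod 𝓘(ℝ, E →L[ℝ] ℝ)) ∞ (fun y ↦ TotalSpace.mk' (E →L[ℝ] ℝ)
      (E := fun y : M ↦ TangentSpace I y →L[ℝ] ℝ) y (γ y)) x) :
    CMDiffAt ∞ (T% (fun y ↦ sharp (γ y))) x := by
  refine contMDiffAt_of_inner fun Y hY ↦ ?_
  have := ContMDiffAt.clm_bundle_apply (IB := I) (F₁ := E) (F₂ := ℝ)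
    (E₁ := fun x : M ↦ TangentSpace I x) (E₂ := Bundle.Trivial M ℝ)
    (b := fun y : M ↦ y) (ϕ := γ) (v := Y) hγ hY
  simp only [contMDiffAt_totalSpace] at this
  simp only [real_inner_comm (sharp _), inner_sharp]
  exact this.2

theorem covDerivForm_innerSL {G : ∀ x : M, TangentSpace I x} {x : M} (hG : MDiffAt (T% G) x)
    (u v : TangentSpace I x) :
    covDerivForm I (fun y ↦ innerSL ℝ (G y)) x u v = ⟪leviCivita I G x u, v⟫_ℝ := by
  have hV : MDiffAt (T% (FiberBundle.extend E v)) x := FiberBundle.mdifferentiableAt_extend ..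
  simp only [covDerivForm, innerSL_apply_apply, leviCivita_metric_vector hG hV,
    FiberBundle.extend_apply_self, add_sub_cancel_right]

theorem isSkewField_wedge (γ : ∀ x : M, TangentSpace I x →L[ℝ] ℝ) (V : ∀ x : M, TangentSpace I x) :
    IsSkewField fun y ↦ wedge (γ y) (V y) :=
  fun _ ↦ wedge_skew _ _

theorem isSmoothEndAt_wedge {G V : ∀ x : M, TangentSpace I x} {x : M}
    (hG : CMDiffAt ∞ (T% G) x) (hV : CMDiffAt ∞ (T% V) x) :
    IsSmoothEndAt (fun y ↦ wedge (innerSL ℝ (G y)) (V y)) x := by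
  intro W hW
  simp only [wedge_innerSL_apply]
  exact ((contMDiffAt_inner hG hW).smul_section hV).sub_section
    ((contMDiffAt_inner hV hW).smul_section hG)

theorem covDerivEnd_wedge {G V : ∀ x : M, TangentSpace I x} {x : M}
    (hG : CMDiffAt ∞ (T% G) x) (hV : CMDiffAt ∞ (T% V) x) (u w : TangentSpace I x) :
    covDerivEnd I (fun y ↦ wedge (innerSL ℝ (G y)) (V y)) x u w =
      (wedge (innerSL ℝ (leviCivita I G x u)) (V x) +
        wedge (innerSL ℝ (G x)) (leviCivita I V x u)) w := by
  have hW := FiberBundle.contMDiffAt_extend (k := ∞) I E w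
  have hGd := hG.mdifferentiableAt (by simp)
  have hVd := hV.mdifferentiableAt (by simp)
  have hWd := hW.mdifferentiableAt (by simp)
  have hGW := contMDiffAt_inner hG hW
  have hVW := contMDiffAt_inner hV hW
  have h1 : CMDiffAt ∞ (T% (fun y ↦ ⟪G y, FiberBundle.extend E w y⟫_ℝ • V y)) x :=
    hGW.smul_section hV
  have h2 : CMDiffAt ∞ (T% (fun y ↦ ⟪V y, FiberBundle.extend E w y⟫_ℝ • G y)) x :=
    hVW.smul_section hG
  simp only [covDerivEnd, wedge_innerSL_apply, add_apply]
  rw [leviCivita_sub (h1.mdifferentiableAt (by simp)) (h2.mdifferentiableAt (by simp)), sub_apply,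
    leviCivita_smul (hGW.mdifferentiableAt (by simp)) hVd,
    leviCivita_smul (hVW.mdifferentiableAt (by simp)) hGd,
    leviCivita_metric_vector hGd hWd, leviCivita_metric_vector hVd hWd]
  simp only [FiberBundle.extend_apply_self]
  module

end OneForms

section FourManifold

variable {M : Type*} [TopologicalSpace M] [ChartedSpace (EuclideanSpace ℝ (Fin 4)) M]
  [IsManifold (𝓡 4) ∞ M] [RiemannianBundle (fun x : M ↦ TangentSpace (𝓡 4) x)]
  [IsContMDiffRiemannianBundle (𝓡 4) ∞ (EuclideanSpace ℝ (Fin 4))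
    (fun x : M ↦ TangentSpace (𝓡 4) x)]
  {o : ∀ x : M, Orientation ℝ (TangentSpace (𝓡 4) x) (Fin 4)}

/-! ### Killing fields and twistors -/

section TwistorEquation

variable {Ψ : ∀ x : M, TangentSpace (𝓡 4) x →L[ℝ] TangentSpace (𝓡 4) x}
  {G : ∀ x : M, TangentSpace (𝓡 4) x}

/-- The second derivative of the field `Ψ W` for a solution `Ψ` of the twistor equation. -/
theorem leviCivita_leviCivita_twistor (ho : IsManifoldOrientation o) (hΨ : IsSkewField Ψ)
    (hs : ∀ x, IsSmoothEndAt Ψ x) (hG : ∀ x, IsSmoothFieldAt G x)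
    (heq : ∀ (x : M) (u w : TangentSpace (𝓡 4) x),
      covDerivEnd (𝓡 4) Ψ x u w = asdEnd (o x) (wedge (innerSL ℝ (G x)) u) w)
    {x : M} {V W : ∀ x : M, TangentSpace (𝓡 4) x} (hV : IsSmoothFieldAt V x)
    (hW : IsSmoothFieldAt W x) (u : TangentSpace (𝓡 4) x) :
    leviCivita (𝓡 4) (fun y ↦ leviCivita (𝓡 4) (fun z ↦ Ψ z (W z)) y (V y)) x u =
      asdEnd (o x) (wedge (innerSL ℝ (leviCivita (𝓡 4) G x u)) (V x)) (W x) +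
      asdEnd (o x) (wedge (innerSL ℝ (G x)) (leviCivita (𝓡 4) V x u)) (W x) +
      asdEnd (o x) (wedge (innerSL ℝ (G x)) (V x)) (leviCivita (𝓡 4) W x u) +
      (asdEnd (o x) (wedge (innerSL ℝ (G x)) u) (leviCivita (𝓡 4) W x (V x)) +
      Ψ x (leviCivita (𝓡 4) (fun y ↦ leviCivita (𝓡 4) W y (V y)) x u)) := by
  have hΨW := hs x _ hW
  have hΩ := isSkewField_wedge (fun y ↦ innerSL ℝ (G y)) V
  have hΩs := isSmoothEndAt_wedge (hG x) hV
  have hΦs := hΩs.isSmoothEndAt_asdEnd ho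
  have hDW := contMDiffAt_leviCivita hV hW
  have h1 : IsSmoothFieldAt (fun y ↦ asdEnd (o y) (wedge (innerSL ℝ (G y)) (V y)) (W y)) x :=
    hΦs W hW
  have h2 : IsSmoothFieldAt (fun y ↦ Ψ y (leviCivita (𝓡 4) W y (V y))) x := hs x _ hDW
  have h3 : IsSmoothFieldAt (fun y ↦ asdEnd (o y) (wedge (innerSL ℝ (G y)) (V y)) (W y) +
      Ψ y (leviCivita (𝓡 4) W y (V y))) x := h1.add_section h2
  have hnear : ∀ᶠ y in nhds x, leviCivita (𝓡 4) (fun z ↦ Ψ z (W z)) y (V y) =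
      asdEnd (o y) (wedge (innerSL ℝ (G y)) (V y)) (W y) +
        Ψ y (leviCivita (𝓡 4) W y (V y)) := by
    filter_upwards [eventually_mdifferentiableAt hW, eventually_mdifferentiableAt hΨW]
      with y hy hy'
    rw [← heq, hΨ.covDerivEnd_apply (hs y) hy hy', sub_add_cancel]
  have e1 := hΩ.isSkewField_asdEnd.covDerivEnd_apply hΦs (hW.mdifferentiableAt (by simp))
    (h1.mdifferentiableAt (by simp)) u
  have e2 := hΨ.covDerivEnd_apply (hs x) (hDW.mdifferentiableAt (by simp))
    (h2.mdifferentiableAt (by simp)) u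
  rw [hΩ.covDerivEnd_asdEnd ho hΩs (covDerivEnd_wedge (hG x) hV u), asdEnd_add, add_apply] at e1
  rw [heq] at e2
  rw [leviCivita_congr ((contMDiffAt_leviCivita hV hΨW).mdifferentiableAt (by simp))
      (h3.mdifferentiableAt (by simp)) hnear,
    leviCivita_add (h1.mdifferentiableAt (by simp)) (h2.mdifferentiableAt (by simp)), add_apply,
    eq_add_of_sub_eq e1.symm, eq_add_of_sub_eq e2.symm]

/-- The Ricci identity for a solution `Ψ` of the twistor equation: the commutator of the curvature
with `Ψ` is given by the derivative of `G`. -/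
theorem curvature_commutator_of_twistor (ho : IsManifoldOrientation o) (hΨ : IsSkewField Ψ)
    (hs : ∀ x, IsSmoothEndAt Ψ x) (hG : ∀ x, IsSmoothFieldAt G x)
    (heq : ∀ (x : M) (u w : TangentSpace (𝓡 4) x),
      covDerivEnd (𝓡 4) Ψ x u w = asdEnd (o x) (wedge (innerSL ℝ (G x)) u) w)
    (x : M) (u v w : TangentSpace (𝓡 4) x) :
    riemann (𝓡 4) x u v (Ψ x w) - Ψ x (riemann (𝓡 4) x u v w) =
      asdEnd (o x) (wedge (innerSL ℝ (leviCivita (𝓡 4) G x u)) v -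
        wedge (innerSL ℝ (leviCivita (𝓡 4) G x v)) u) w := by
  have hext (v : TangentSpace (𝓡 4) x) :=
    FiberBundle.contMDiffAt_extend (k := ∞) (𝓡 4) (EuclideanSpace ℝ (Fin 4)) v
  have hval (v : TangentSpace (𝓡 4) x) :=
    FiberBundle.extend_apply_self (EuclideanSpace ℝ (Fin 4)) v
  have hΨW := hs x _ (hext w)
  have key (u v : TangentSpace (𝓡 4) x) :=
    leviCivita_leviCivita_twistor ho hΨ hs hG heq (hext v) (hext w) u
  have hbr := leviCivita_bracket ((hext u).mdifferentiableAt (by simp))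
    ((hext v).mdifferentiableAt (by simp))
  have e3 := hΨ.covDerivEnd_apply (hs x) ((hext w).mdifferentiableAt (by simp))
    (hΨW.mdifferentiableAt (by simp)) (VectorField.mlieBracket (𝓡 4)
      (FiberBundle.extend (EuclideanSpace ℝ (Fin 4)) u)
      (FiberBundle.extend (EuclideanSpace ℝ (Fin 4)) v) x)
  have hR := fieldCurvature_extend u v hΨW
  rw [heq, hval] at e3
  simp only [hval] at hR hbr key
  rw [← hR, fieldCurvature, hval, hval, key u v, key v u, eq_add_of_sub_eq e3.symm, riemann, ← hbr,
    wedge_sub_right]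
  simp only [asdEnd_sub, sub_apply, map_sub]
  abel

end TwistorEquation

/-- The derivative of the antiselfdual part of `D K`, for a Killing field `K`. -/
theorem covDerivEnd_asdDeriv (ho : IsManifoldOrientation o) (hS : IsSelfdual o)
    {K : ∀ x : M, TangentSpace (𝓡 4) x} (hK : IsKilling (𝓡 4) K) {c : ℝ} {x : M}
    (hE : ∀ u v : TangentSpace (𝓡 4) x, ricci (𝓡 4) x u v = c * ⟪u, v⟫_ℝ)
    (u w : TangentSpace (𝓡 4) x) :
    covDerivEnd (𝓡 4) (asdDeriv o K) x u w =
      (c / 3) • asdEnd (o x) (wedge (innerSL ℝ (K x)) u) w := by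
  have h := hK.isSkewField.covDerivEnd_asdEnd ho (hK.isSmoothEndAt x)
    (A := skewMap (riemann (𝓡 4) x u (K x)) (inner_riemann u (K x)))
    (fun w ↦ hK.covDerivEnd_leviCivita x u w) w
  rw [hS.asdEnd_riemann hE] at h
  exact h

theorem isTwistor_asdDeriv (ho : IsManifoldOrientation o) (hS : IsSelfdual o)
    (hE : IsEinstein M) {K : ∀ x : M, TangentSpace (𝓡 4) x} (hK : IsKilling (𝓡 4) K) :
    IsTwistor o (asdDeriv o K) := by
  obtain ⟨c, hc⟩ := hE
  refine ⟨fun y ↦ innerSL ℝ ((c / 3) • K y), fun x ↦ ?_, fun x ↦ ?_, fun x ↦ ⟨?_, ?_⟩,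
    fun x u w ↦ ?_⟩
  · exact ((hK.isSmoothEndAt x).isSmoothEndAt_asdEnd ho).contMDiffAt
  · exact contMDiffAt_innerSL ((contMDiffAt_const (c := c / 3)).smul_section (hK.1 x))
  · exact asdEnd_skew (o x) (hK.2 x)
  · exact asdEnd_asdEnd (o x) (hK.2 x)
  · rw [covDerivEnd_asdDeriv ho hS hK (hc x), map_smul, wedge_smul_left, asdEnd_smul, smul_apply]

theorem IsTwistorWith.isSmoothEndAt
    {Ψ : ∀ x : M, TangentSpace (𝓡 4) x →L[ℝ] TangentSpace (𝓡 4) x}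
    {γ : ∀ x : M, TangentSpace (𝓡 4) x →L[ℝ] ℝ} (h : IsTwistorWith o Ψ γ) (x : M) :
    IsSmoothEndAt Ψ x :=
  fun _ hV ↦ (h.smooth_endomorphism x).clm_bundle_apply hV

/-- The vector field dual to the `1`-form of a twistor `Ψ` satisfies the Killing equation, and the
antiselfdual part of its derivative is a multiple of `Ψ`. -/
theorem IsTwistorWith.skew_sharp (ho : IsManifoldOrientation o) (hS : IsSelfdual o)
    {Ψ : ∀ x : M, TangentSpace (𝓡 4) x →L[ℝ] TangentSpace (𝓡 4) x}
    {γ : ∀ x : M, TangentSpace (𝓡 4) x →L[ℝ] ℝ} (h : IsTwistorWith o Ψ γ) {c : ℝ} {x : M}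
    (hE : ∀ u v : TangentSpace (𝓡 4) x, ricci (𝓡 4) x u v = c * ⟪u, v⟫_ℝ) :
    (∀ u v, ⟪leviCivita (𝓡 4) (fun y ↦ sharp (γ y)) x u, v⟫_ℝ =
      -⟪u, leviCivita (𝓡 4) (fun y ↦ sharp (γ y)) x v⟫_ℝ) ∧
    asdEnd (o x) (leviCivita (𝓡 4) (fun y ↦ sharp (γ y)) x) = (c / 3) • Ψ x := by
  refine skew_of_curvature_commutator (o x)
    (R := fun u v ↦ skewMap (riemann (𝓡 4) x u v) (inner_riemann u v)) (h.antiselfdual x)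
    (fun u v ↦ inner_riemann u v) (hS.asdEnd_riemann hE) fun u v ↦ ?_
  ext1 w
  exact curvature_commutator_of_twistor ho (fun x ↦ (h.antiselfdual x).1) h.isSmoothEndAt
    (fun x ↦ contMDiffAt_sharp (h.smooth_form x))
    (fun x u w ↦ by rw [h.equation, innerSL_sharp]) x u v w

end FourManifold

end SelfdualEinstein

theorem mainTheorem4 {M : Type*} [TopologicalSpace M] [T2Space M]
    [ChartedSpace (EuclideanSpace ℝ (Fin 4)) M] [IsManifold (𝓡 4) ∞ M]
    [RiemannianBundle (fun x : M ↦ TangentSpace (𝓡 4) x)]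
    [IsContMDiffRiemannianBundle (𝓡 4) ∞ (EuclideanSpace ℝ (Fin 4))
      (fun x : M ↦ TangentSpace (𝓡 4) x)]
    (o : ∀ x : M, Orientation ℝ (TangentSpace (𝓡 4) x) (Fin 4))
    (ho : IsManifoldOrientation o) (hE : IsEinstein M) (hS : IsSelfdual o) :
    (∀ K : ∀ x : M, TangentSpace (𝓡 4) x, IsKilling (𝓡 4) K →
      (∀ (x : M) (X Y : TangentSpace (𝓡 4) x),
        covDerivEnd (𝓡 4) (asdDeriv o K) x X Y =
          (normScal x / 2) • asdEnd (o x) (wedge (innerSL ℝ (K x)) X) Y) ∧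
      IsTwistor o (asdDeriv o K)) ∧
    (∀ (Ψ : ∀ x : M, TangentSpace (𝓡 4) x →L[ℝ] TangentSpace (𝓡 4) x)
      (γ : ∀ x : M, TangentSpace (𝓡 4) x →L[ℝ] ℝ), IsTwistorWith o Ψ γ →
      IsKilling (𝓡 4) (fun x ↦ sharp (γ x)) ∧
      ∀ (x : M) (X Y : TangentSpace (𝓡 4) x),
        asdForm (o x) (covDerivForm (𝓡 4) γ x) X Y = (normScal x / 2) * ⟪Ψ x X, Y⟫_ℝ) := by
  obtain ⟨c, hc⟩ := hE
  have hs (x : M) : normScal x / 2 = c / 3 := by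
    rw [normScal, scal_of_ricci (hc x)]
    ring
  refine ⟨fun K hK ↦ ⟨fun x X Y ↦ ?_, isTwistor_asdDeriv ho hS ⟨c, hc⟩ hK⟩,
    fun Ψ γ h ↦ ⟨⟨fun x ↦ contMDiffAt_sharp (h.smooth_form x),
      fun x ↦ (h.skew_sharp ho hS (hc x)).1⟩, fun x X Y ↦ ?_⟩⟩
  · rw [hs, covDerivEnd_asdDeriv ho hS hK (hc x)]
  · have hγ : covDerivForm (𝓡 4) γ x =
        fun u v ↦ ⟪leviCivita (𝓡 4) (fun y ↦ sharp (γ y)) x u, v⟫_ℝ := by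
      funext u v
      rw [← covDerivForm_innerSL
        ((contMDiffAt_sharp (h.smooth_form x)).mdifferentiableAt (by simp))]
      simp only [innerSL_sharp]
    rw [hγ, asdForm_inner, (h.skew_sharp ho hS (hc x)).2, hs, smul_apply, inner_smul_left,
      RCLike.conj_to_real]
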